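/- **Setting.** Let $\rho$ be a random variable on a probability space whose law is log-normal and non-degenerate ($\log\rho\sim N(m,v)$ with $v>0$), let $F$ be its distribution function and $F^{-1}(p)=\inf\{x:F(x)\ge p\}$ its quantile function. Let $U:[0,\infty)\to[0,\infty)$ be strictly concave, differentiable on $(0,\infty)$, with $U'(0+)=\infty$, $U'(+\infty)=0$, and let $(U')^{-1}:(0,\infty)\to(0,\infty)$ be the inverse of $U'$. Let $\alpha\in(0,1)$, $\ell\ge 0$, $\kappa,z_0\in\mathbb R$, and put $\overline z=z_0-\ell\,\mathbb E[\rho]$, $\underline z=\max\{\kappa-\ell,0\}$. Assume that, if $\overline z>0$, the benchmark problem $\sup\{\mathbb E[U(Z)]: Z\ge\ell\text{ a.s.},\ \mathbb E[\rho Z]\le z_0\}$ is feasible with a finite value. Let $\mathcal G$ be the set of nonnegative, increasing, left-continuous functions on $(0,1)$. The quantile problem (e4) is $$\sup_{G\in\mathcal G}\int_0^1U(G(z)+\ell)\,dz\quad\text{s.t.}\quad \int_0^1G(z)F^{-1}(1-z)\,dz\le\overline z,\qquad \frac1\alpha\int_0^\alpha G(z)\,dz\ge\underline z .$$ Let $\hat\lambda$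 be the unique root on $(0,\infty)$ of $$\eta(\lambda)=-\int_{1-F(\lambda/\alpha)}^1F^{-1}(1-y)\,dy+\lambda\,\frac{\alpha-1+F(\lambda/\alpha)}{\alpha},$$ and put $R(\underline z)=\hat\lambda\,\underline z$. For $\underline z>0$ let $\underline\lambda>0$ be the unique number with $\frac1\alpha\int_0^\alpha\big((U')^{-1}(\underline\lambda F^{-1}(1-z))-\ell\big)^+dz=\underline z$, and put $C(\underline z)=\int_0^1\big((U')^{-1}(\underline\lambda F^{-1}(1-z))-\ell\big)^+F^{-1}(1-z)\,dz$. For $\lambda,\nu>0$ put $\varphi_\lambda(z)=-\int_z^1F^{-1}(1-y)\,dy+\lambda\frac{\alpha-z}{\alpha}I_{\{z\le\alpha\}}$ and $\varphi_\lambda'(z)=F^{-1}(1-z)-\frac\lambda\alpha I_{\{z\le\alpha\}}$. The auxiliary problem is $$\sup_{G\in\mathcal G}\int_0^1\big(U(G(z)+\ell)-\nu G(z)\varphi'_\lambda(z)\big)dz+\nu\overline z-\lambda\nu\underline z,$$ the integral being taken in $[-\infty,\infty]$ with $\infty-\infty=-\infty$. For $0<\lambda<\hat\lambda$ let $s(z)=1-F\big(F^{-1}(1-z)+\frac\lambda\alpha\big)$,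 let $z_2$ be the unique $z\in(\alpha,1)$ with $\varphi_\lambda(z)-\varphi_\lambda(s(z))-\varphi_\lambda'(z)(z-s(z))=0$, and let $z_1=s(z_2)$. Let $\delta'_\lambda(z)$ be $F^{-1}(1-z)-\frac\lambda\alpha$ for $z\le z_1$, $F^{-1}(1-z_2)$ for $z_1<z\le z_2$, and $F^{-1}(1-z)$ for $z>z_2$. Let $t(c)=1-F\big(c+\frac1\nu U'(\ell)\big)$ if $\ell>0$, and $t(c)=0$ if $\ell=0$. If $z_2\ge t(0)$, let $G^*_{\lambda,\nu}(z)=0$ for $z\le t(\lambda/\alpha)$ and $G^*_{\lambda,\nu}(z)=(U')^{-1}(\nu\delta'_\lambda(z))-\ell$ for $z>t(\lambda/\alpha)$. If $z_2<t(0)$, let $G^*_{\lambda,\nu}(z)=0$ for $z\le t(0)$ and $G^*_{\lambda,\nu}(z)=(U')^{-1}(\nu F^{-1}(1-z))-\ell$ for $z>t(0)$. **Theorem.** Assume $\underline z>0$, $C(\underline z)<\infty$ and $R(\underline z)<\overline z<C(\underline z)$. Then there is a pair $(\lambda^*,\nu^*)\in(0,\hat\lambda)\times(0,\infty)$ such that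 $G^*_{\lambda^*,\nu^*}$ is the unique optimal solution, with finite value, of the auxiliary problem with multipliers $(\lambda^*,\nu^*)$, $$\int_0^1G^*_{\lambda^*,\nu^*}(z)F^{-1}(1-z)\,dz=\overline z,\qquad \frac1\alpha\int_0^\alpha G^*_{\lambda^*,\nu^*}(z)\,dz=\underline z,$$ and $G^*_{\lambda^*,\nu^*}$ is the unique optimal solution, with finite value, of the quantile problem (e4). -/

import Mathlib

open MeasureTheory ProbabilityTheory Set Filter Topology
open scoped ENNReal NNReal

noncomputable section

namespace TVaRPI

/-- The log-normal law with parameters `m` and `v`: the law of `exp N` with `N` Gaussian. -/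
def logNormal (m : ℝ) (v : ℝ≥0) : Measure ℝ := (gaussianReal m v).map Real.exp

/-- The left-continuous quantile function `F⁻¹(p) = inf {x | F(x) ≥ p}` of a law on `ℝ`. -/
def quantile (μ : Measure ℝ) (p : ℝ) : ℝ := sInf {x : ℝ | p ≤ cdf μ x}

/-- Utility functions on `[0, ∞)`; the values at negative arguments are irrelevant. -/
structure IsUtility (U : ℝ → ℝ) : Prop where
  nonneg : ∀ x, 0 ≤ x → 0 ≤ U x
  differentiableOn : DifferentiableOn ℝ U (Ioi 0)
  strictConcaveOn : StrictConcaveOn ℝ (Ici 0) U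
  inada_zero : Tendsto (deriv U) (𝓝[>] 0) atTop
  inada_top : Tendsto (deriv U) atTop (𝓝 0)

/-- The inverse `(U')⁻¹ : (0, ∞) → (0, ∞)` of the marginal utility. -/
def invMarginal (U : ℝ → ℝ) : ℝ → ℝ := Function.invFunOn (deriv U) (Ioi 0)

/-- The Lebesgue integral over `(0, 1)` with values in `[-∞, ∞]` (positive part minus negative
part; `∞ - ∞ = -∞`). -/
def extIntegral (f : ℝ → ℝ) : EReal :=
  ((∫⁻ z in Ioo (0 : ℝ) 1, ENNReal.ofReal (f z) : ℝ≥0∞) : EReal)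
    - ((∫⁻ z in Ioo (0 : ℝ) 1, ENNReal.ofReal (-f z) : ℝ≥0∞) : EReal)

/-! ### The benchmark problem (over random variables) -/

/-- Candidates of the benchmark problem: `Z ≥ ℓ` almost surely and `E[ρ Z] ≤ z₀`. -/
def BenchmarkFeasible {Ω : Type*} [MeasurableSpace Ω] (P : Measure Ω) (ρ : Ω → ℝ)
    (ℓ z₀ : ℝ) (Z : Ω → ℝ) : Prop :=
  Measurable Z ∧ (∀ᵐ ω ∂P, ℓ ≤ Z ω) ∧
    Integrable (fun ω => ρ ω * Z ω) P ∧ ∫ ω, ρ ω * Z ω ∂P ≤ z₀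

/-- The benchmark problem `sup E[U(Z)]` is feasible and has a finite optimal value. -/
def BenchmarkWellPosed {Ω : Type*} [MeasurableSpace Ω] (P : Measure Ω) (ρ : Ω → ℝ)
    (U : ℝ → ℝ) (ℓ z₀ : ℝ) : Prop :=
  (∃ Z, BenchmarkFeasible P ρ ℓ z₀ Z) ∧
    (⨆ (Z : Ω → ℝ) (_ : BenchmarkFeasible P ρ ℓ z₀ Z),
      ∫⁻ ω, ENNReal.ofReal (U (Z ω)) ∂P) < ⊤

/-- `z̄ = z₀ - ℓ E[ρ]`. -/
def zBar {Ω : Type*} [MeasurableSpace Ω] (P : Measure Ω) (ρ : Ω → ℝ) (ℓ z₀ : ℝ) : ℝ :=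
  z₀ - ℓ * ∫ ω, ρ ω ∂P

/-- `z̲ = max (κ - ℓ) 0`. -/
def zLow (κ ℓ : ℝ) : ℝ := max (κ - ℓ) 0

/-! ### The quantile problem -/

/-- Quantile functions of nonnegative random variables: nonnegative, increasing and
left-continuous on `(0, 1)`. -/
def IsQuantile (G : ℝ → ℝ) : Prop :=
  (∀ z ∈ Ioo (0 : ℝ) 1, 0 ≤ G z) ∧ MonotoneOn G (Ioo 0 1) ∧
    ∀ z ∈ Ioo (0 : ℝ) 1, ContinuousWithinAt G (Iic z) z

/-- `G` is an optimal solution of the problem of maximizing `J` over the feasible functions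
`Feas`, it has a finite value, and it is the only optimal solution, up to the irrelevant values
outside `(0, 1)`. -/
def IsUniqueMaximizer (Feas : (ℝ → ℝ) → Prop) (J : (ℝ → ℝ) → EReal) (G : ℝ → ℝ) : Prop :=
  Feas G ∧ J G ≠ ⊤ ∧ J G ≠ ⊥ ∧ (∀ H, Feas H → J H ≤ J G) ∧
    ∀ H, Feas H → J H = J G → EqOn H G (Ioo 0 1)

/-- Candidates of the quantile problem with budget constraint and left TVaR constraint. -/
def QuantileFeasible (μ : Measure ℝ) (α zbar zlow : ℝ) (G : ℝ → ℝ) : Prop :=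
  IsQuantile G ∧
    IntegrableOn (fun z => G z * quantile μ (1 - z)) (Ioo 0 1) ∧
    ∫ z in Ioo (0 : ℝ) 1, G z * quantile μ (1 - z) ≤ zbar ∧
    zlow ≤ 1 / α * ∫ z in Ioo (0 : ℝ) α, G z

/-- The objective `∫₀¹ U(G(z) + ℓ) dz` of the quantile problem. -/
def quantileObjective (U : ℝ → ℝ) (ℓ : ℝ) (G : ℝ → ℝ) : EReal :=
  extIntegral fun z => U (G z + ℓ)

/-! ### The thresholds `R` and `C` -/

/-- The function `η`. -/
def eta (μ : Measure ℝ) (α lam : ℝ) : ℝ :=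
  -(∫ y in (1 - cdf μ (lam / α))..1, quantile μ (1 - y))
    + lam * ((α - 1 + cdf μ (lam / α)) / α)

/-- `λ̂`, the unique root of `η` on `(0, ∞)`. -/
def lamHat (μ : Measure ℝ) (α : ℝ) : ℝ := sInf {lam : ℝ | 0 < lam ∧ eta μ α lam = 0}

/-- `R(z̲) = λ̂ z̲`. -/
def thresholdR (μ : Measure ℝ) (α zlow : ℝ) : ℝ := lamHat μ α * zlow

/-- `z ↦ ((U')⁻¹(λ F⁻¹(1 - z)) - ℓ)⁺`. -/
def mertonQuantile (μ : Measure ℝ) (U : ℝ → ℝ) (ℓ lam z : ℝ) : ℝ :=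
  max (invMarginal U (lam * quantile μ (1 - z)) - ℓ) 0

/-- `λ̲(z̲)`, for `z̲ > 0` the unique `λ > 0` for which the left TVaR of `mertonQuantile` is `z̲`. -/
def lamLow (μ : Measure ℝ) (U : ℝ → ℝ) (α ℓ zlow : ℝ) : ℝ :=
  sInf {lam : ℝ | 0 < lam ∧ 1 / α * ∫ z in Ioo (0 : ℝ) α, mertonQuantile μ U ℓ lam z = zlow}

/-- The integrand of `C(z̲)`. -/
def integrandC (μ : Measure ℝ) (U : ℝ → ℝ) (α ℓ zlow z : ℝ) : ℝ :=
  mertonQuantile μ U ℓ (lamLow μ U α ℓ zlow) z * quantile μ (1 - z)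

/-- `C(z̲)`; meaningful when `integrandC` is integrable, that is, when `C(z̲) < ∞`. -/
def thresholdC (μ : Measure ℝ) (U : ℝ → ℝ) (α ℓ zlow : ℝ) : ℝ :=
  ∫ z in Ioo (0 : ℝ) 1, integrandC μ U α ℓ zlow z

/-! ### The auxiliary problem and its optimizer -/

/-- `φ_λ`. -/
def phi (μ : Measure ℝ) (α lam z : ℝ) : ℝ :=
  -(∫ y in z..1, quantile μ (1 - y)) + if z ≤ α then lam * ((α - z) / α) else 0

/-- The left derivative `φ'_λ`. -/
def phi' (μ : Measure ℝ) (α lam z : ℝ) : ℝ :=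
  quantile μ (1 - z) - if z ≤ α then lam / α else 0

/-- The objective of the auxiliary problem with multipliers `(λ, ν)`. -/
def auxObjective (μ : Measure ℝ) (U : ℝ → ℝ) (α ℓ zbar zlow lam ν : ℝ) (G : ℝ → ℝ) : EReal :=
  extIntegral (fun z => U (G z + ℓ) - ν * G z * phi' μ α lam z)
    + ((ν * zbar - lam * ν * zlow : ℝ) : EReal)

/-- `s(z) = 1 - F(F⁻¹(1 - z) + λ / α)`. -/
def sMap (μ : Measure ℝ) (α lam z : ℝ) : ℝ := 1 - cdf μ (quantile μ (1 - z) + lam / α)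

/-- `z₂(λ)`, for `0 < λ < λ̂` the unique solution of the tangency equation on `(α, 1)`. -/
def zTwo (μ : Measure ℝ) (α lam : ℝ) : ℝ :=
  sInf {z : ℝ | z ∈ Ioo α 1 ∧
    phi μ α lam z - phi μ α lam (sMap μ α lam z)
      - phi' μ α lam z * (z - sMap μ α lam z) = 0}

/-- `z₁(λ) = s(z₂(λ))`. -/
def zOne (μ : Measure ℝ) (α lam : ℝ) : ℝ := sMap μ α lam (zTwo μ α lam)

/-- `1 - F(c + U'(ℓ) / ν)`, which is `0` for `ℓ = 0` because `U'(0+) = ∞`. -/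
def startPoint (μ : Measure ℝ) (U : ℝ → ℝ) (ℓ ν c : ℝ) : ℝ :=
  if ℓ = 0 then 0 else 1 - cdf μ (c + deriv U ℓ / ν)

/-- `δ'_λ`, the slope of the concave envelope of `φ_λ`. -/
def deltaSlope (μ : Measure ℝ) (α lam z : ℝ) : ℝ :=
  if z ≤ zOne μ α lam then quantile μ (1 - z) - lam / α
  else if z ≤ zTwo μ α lam then quantile μ (1 - zTwo μ α lam)
  else quantile μ (1 - z)

/-- The optimizer `G*_{λ,ν}` of the auxiliary problem. -/
def Gstar (μ : Measure ℝ) (U : ℝ → ℝ) (α ℓ lam ν z : ℝ) : ℝ :=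
  if startPoint μ U ℓ ν 0 ≤ zTwo μ α lam then
    if z ≤ startPoint μ U ℓ ν (lam / α) then 0
    else invMarginal U (ν * deltaSlope μ α lam z) - ℓ
  else
    if z ≤ startPoint μ U ℓ ν 0 then 0
    else invMarginal U (ν * quantile μ (1 - z)) - ℓ

end TVaRPI

end

open TVaRPI

/-! The quantile problem is solved by Lagrange multipliers. Write `q z = F⁻¹(1 - z)` and
`a = λ / α`.

*Optimality.* The difference of the slope `φ'_λ = q - a 1_{z ≤ α}` and the slope of the concave
envelope is `-(b - q)⁺` on `(0, α]` and `(q - c)⁺` on `(α, 1)`, where `c = q z₂` and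
`b = q z₁ = c + a`. The tangency equation says that its integral vanishes. Hence its integral
against an increasing function `H` is that of `H - H α`, which is nonnegative since both factors
change sign at `α`; it is zero for functions of the slope of the envelope
(`IsKernel.integral_mul_slopeGap_nonneg`, `IsKernel.integral_comp_mul_slopeGap`). So `φ'_λ` may be
replaced by the slope of the envelope, and then `G*` is the pointwise maximizer
(`IsUtility.lt_excessDemand`). Pointwise strictness and left-continuity give uniqueness
(`IsEnvelopeDemand.isUniqueMaximizer_aux`). When both constraints bind, the quantile problem
reduces to the auxiliary one (`IsEnvelopeDemand.isUniqueMaximizer_quantile`).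

*Existence of the multipliers.* The multipliers `λ ∈ (0, λ̂)` correspond to the points `c` of
`(0, q α)`: the tangency equation reads `∫₀^α (b - q)⁺ = ∫_α¹ (q - c)⁺`, which determines `b` as a
continuous decreasing function of `c` (`IsTangency`), with `λ = α (b c - c)`. For each `c` exactly
one `ν c` makes the tail constraint bind (`IsMultiplier`), and it depends continuously on `c`. At
`c = q α` one has `λ = 0`, and the cost of the resulting `G*` is the threshold `C`. As `c ↓ 0`,
`ν c` tends to infinity, and the cost, which is `λ z̲` plus the cost at the prices given by the
envelope, tends to `R = λ̂ z̲` (`IsMultiplier.curveBudget_eq`,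
`IsMultiplier.tendsto_integral_zero`). The intermediate value theorem gives a `c` at which the
budget constraint binds too (`IsMultiplier.exists_curveBudget_eq`).

*Finiteness.* The cost is finite since `ν c ≥ ν (q α)`, so that `G*` is a bounded function plus at
most the demand in `C`. At the `c` found above, `G* + ℓ` is, as a function of the pricing kernel,
a candidate of the benchmark problem, so that its expected utility is finite
(`integrableOn_utility_of_benchmark`). -/

namespace TVaRPI

/-! ### Utility functions and the excess demand -/

section Utility

variable {U : ℝ → ℝ}

lemma IsUtility.differentiableAt (hU : IsUtility U) {x : ℝ} (hx : 0 < x) :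
    DifferentiableAt ℝ U x :=
  hU.differentiableOn.differentiableAt (Ioi_mem_nhds hx)

lemma IsUtility.strictAntiOn_deriv (hU : IsUtility U) : StrictAntiOn (deriv U) (Ioi 0) :=
  (hU.strictConcaveOn.subset Ioi_subset_Ici_self (convex_Ioi 0)).strictAntiOn_deriv
    fun _ hx => hU.differentiableAt hx

lemma IsUtility.deriv_pos (hU : IsUtility U) {x : ℝ} (hx : 0 < x) : 0 < deriv U x := by
  have h1 : deriv U (x + 1) < deriv U x :=
    hU.strictAntiOn_deriv hx (mem_Ioi.2 (by linarith)) (by linarith)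
  have h2 : 0 ≤ deriv U (x + 1) := by
    refine le_of_tendsto hU.inada_top ?_
    filter_upwards [eventually_gt_atTop (x + 1)] with y hy
    exact (hU.strictAntiOn_deriv (mem_Ioi.2 (by linarith)) (mem_Ioi.2 (by linarith)) hy).le
  linarith

/-- The derivative of a differentiable function has the Darboux property, so that the Inada
conditions make the marginal utility a bijection of `(0, ∞)`. -/
lemma IsUtility.image_deriv (hU : IsUtility U) : deriv U '' Ioi 0 = Ioi 0 := by
  apply Subset.antisymm
  · rintro _ ⟨x, hx, rfl⟩
    exact hU.deriv_pos hx
  · intro y hy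
    have hord : OrdConnected (deriv U '' Ioi 0) :=
      (ordConnected_Ioi : OrdConnected (Ioi (0 : ℝ))).image_deriv
        fun x hx => hU.differentiableAt hx
    obtain ⟨x₁, h₁, h₁'⟩ :=
      ((hU.inada_zero.eventually_gt_atTop y).and self_mem_nhdsWithin).exists
    obtain ⟨x₂, h₂, h₂'⟩ :=
      ((hU.inada_top.eventually_lt_const hy).and (eventually_gt_atTop 0)).exists
    exact hord.out ⟨x₂, h₂', rfl⟩ ⟨x₁, h₁', rfl⟩ ⟨h₂.le, h₁.le⟩

lemma IsUtility.invMarginal_pos (hU : IsUtility U) {y : ℝ} (hy : 0 < y) :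
    0 < invMarginal U y :=
  Function.invFunOn_mem (hU.image_deriv.symm ▸ hy : y ∈ deriv U '' Ioi 0)

lemma IsUtility.deriv_invMarginal (hU : IsUtility U) {y : ℝ} (hy : 0 < y) :
    deriv U (invMarginal U y) = y :=
  Function.invFunOn_eq (hU.image_deriv.symm ▸ hy : y ∈ deriv U '' Ioi 0)

lemma IsUtility.invMarginal_deriv (hU : IsUtility U) {x : ℝ} (hx : 0 < x) :
    invMarginal U (deriv U x) = x :=
  hU.strictAntiOn_deriv.injOn (hU.invMarginal_pos (hU.deriv_pos hx)) hx
    (hU.deriv_invMarginal (hU.deriv_pos hx))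

lemma IsUtility.strictAntiOn_invMarginal (hU : IsUtility U) :
    StrictAntiOn (invMarginal U) (Ioi 0) := by
  intro x hx y hy hxy
  rw [← hU.strictAntiOn_deriv.lt_iff_gt (hU.invMarginal_pos hx) (hU.invMarginal_pos hy),
    hU.deriv_invMarginal hx, hU.deriv_invMarginal hy]
  exact hxy

lemma IsUtility.image_invMarginal (hU : IsUtility U) : invMarginal U '' Ioi 0 = Ioi 0 := by
  apply Subset.antisymm
  · rintro _ ⟨x, hx, rfl⟩
    exact hU.invMarginal_pos hx
  · exact fun y hy => ⟨deriv U y, hU.deriv_pos hy, hU.invMarginal_deriv hy⟩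

end Utility

lemma continuousAt_of_strictAntiOn_of_image_mem_nhds {f : ℝ → ℝ} {s : Set ℝ} {a : ℝ}
    (hf : StrictAntiOn f s) (hs : s ∈ 𝓝 a) (hfs : f '' s ∈ 𝓝 (f a)) : ContinuousAt f a := by
  have h := StrictMonoOn.continuousAt_of_image_mem_nhds (f := fun x => -f x) hf.neg hs (by
    have : (fun x => -f x) '' s = Neg.neg ⁻¹' (f '' s) := by
      ext y
      simp only [mem_image, mem_preimage]
      exact exists_congr fun x => and_congr_right fun _ => neg_eq_iff_eq_neg
    rw [this]
    exact continuous_neg.continuousAt.preimage_mem_nhds (by simpa using hfs))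
  exact continuous_neg.continuousAt.comp h |>.congr (Eventually.of_forall fun x => neg_neg (f x))

section Utility

variable {U : ℝ → ℝ}

lemma IsUtility.continuousOn_invMarginal (hU : IsUtility U) :
    ContinuousOn (invMarginal U) (Ioi 0) := fun y hy =>
  (continuousAt_of_strictAntiOn_of_image_mem_nhds hU.strictAntiOn_invMarginal (Ioi_mem_nhds hy)
    (by rw [hU.image_invMarginal]
        exact Ioi_mem_nhds (hU.invMarginal_pos hy))).continuousWithinAt

/-- A strictly concave function lies strictly below its tangents. -/
lemma IsUtility.lt_tangent (hU : IsUtility U) {x y : ℝ} (hx : 0 ≤ x) (hy : 0 < y) (hxy : x ≠ y) :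
    U x < U y + deriv U y * (x - y) := by
  rcases hxy.lt_or_gt with h | h
  · have := hU.strictConcaveOn.deriv_lt_slope hx hy.le h (hU.differentiableAt hy)
    rw [slope_def_field, lt_div_iff₀ (by linarith)] at this
    linarith
  · have := hU.strictConcaveOn.slope_lt_deriv hy.le hx h (hU.differentiableAt hy)
    rw [slope_def_field, div_lt_iff₀ (by linarith)] at this
    linarith

lemma IsUtility.strictMonoOn (hU : IsUtility U) : StrictMonoOn U (Ici 0) := by
  intro x hx y hy hxy
  have hy' : 0 < y := lt_of_le_of_lt hx hxy
  have h := hU.lt_tangent hx hy' hxy.ne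
  nlinarith [hU.deriv_pos hy']

/-- The optimal excess `((U')⁻¹(y) - ℓ)⁺` of consumption over the floor `ℓ` at the price `y`. -/
noncomputable def excessDemand (U : ℝ → ℝ) (ℓ y : ℝ) : ℝ := max (invMarginal U y - ℓ) 0

/-- `excessDemand U ℓ y` maximizes the concave function `x ↦ U (x + ℓ) - y x` on `[0, ∞)`. -/
lemma IsUtility.lt_excessDemand (hU : IsUtility U) {ℓ y x : ℝ} (hℓ : 0 ≤ ℓ) (hy : 0 < y)
    (hx : 0 ≤ x) (hne : x ≠ excessDemand U ℓ y) :
    U (x + ℓ) - y * x < U (excessDemand U ℓ y + ℓ) - y * excessDemand U ℓ y := by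
  have hI := hU.invMarginal_pos hy
  unfold excessDemand at hne ⊢
  rcases le_total ℓ (invMarginal U y) with h | h
  · rw [max_eq_left (by linarith)] at hne ⊢
    have ht := hU.lt_tangent (x := x + ℓ) (by linarith) hI (fun h => hne (by linarith))
    rw [hU.deriv_invMarginal hy] at ht
    rw [sub_add_cancel]
    linarith
  · rw [max_eq_right (by linarith)] at hne ⊢
    have hℓ' : 0 < ℓ := hI.trans_le h
    have ht := hU.lt_tangent (x := x + ℓ) (by linarith) hℓ' (fun h => hne (by linarith))
    have hd : deriv U ℓ ≤ y := by
      have := hU.strictAntiOn_deriv.antitoneOn hI hℓ' h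
      rwa [hU.deriv_invMarginal hy] at this
    have hx' : deriv U ℓ * x ≤ y * x := mul_le_mul_of_nonneg_right hd hx
    rw [zero_add]
    linarith

end Utility

/-- The properties of `excessDemand U ℓ` that determine the behaviour of the multipliers. -/
structure IsDemand (W : ℝ → ℝ) : Prop where
  nonneg : ∀ y, 0 ≤ W y
  continuousOn : ContinuousOn W (Ioi 0)
  antitoneOn : AntitoneOn W (Ioi 0)
  lt_of_pos : ∀ x y, 0 < x → x < y → 0 < W x → W y < W x
  tendsto_top : Tendsto W atTop (𝓝 0)
  exists_gt : ∀ M, ∃ ε, 0 < ε ∧ M < W ε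

lemma IsUtility.isDemand {U : ℝ → ℝ} (hU : IsUtility U) {ℓ : ℝ} (hℓ : 0 ≤ ℓ) :
    IsDemand (excessDemand U ℓ) where
  nonneg y := le_max_right _ _
  continuousOn := ContinuousOn.sup (f := fun y => invMarginal U y - ℓ)
    (hU.continuousOn_invMarginal.sub continuousOn_const) continuousOn_const
  antitoneOn x hx y hy hxy :=
    max_le_max_right _ (sub_le_sub_right (hU.strictAntiOn_invMarginal.antitoneOn hx hy hxy) _)
  lt_of_pos x y hx hxy hpos := by
    have h := hU.strictAntiOn_invMarginal hx (mem_Ioi.2 (hx.trans hxy)) hxy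
    refine max_lt ?_ hpos
    exact lt_of_lt_of_le (by linarith) (le_max_left _ _)
  tendsto_top := by
    rw [tendsto_order]
    refine ⟨fun a ha => Eventually.of_forall fun y => lt_of_lt_of_le ha (le_max_right _ _),
      fun a ha => ?_⟩
    have ha' : 0 < a + ℓ := by linarith
    filter_upwards [eventually_gt_atTop (deriv U (a + ℓ))] with y hy
    have h := hU.strictAntiOn_invMarginal (hU.deriv_pos ha')
      (mem_Ioi.2 ((hU.deriv_pos ha').trans hy)) hy
    rw [hU.invMarginal_deriv ha'] at h
    exact max_lt (by linarith) ha
  exists_gt M := by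
    have hM : 0 < |M| + ℓ + 1 := by positivity
    refine ⟨_, hU.deriv_pos hM, lt_of_lt_of_le ?_ (le_max_left _ _)⟩
    rw [hU.invMarginal_deriv hM]
    linarith [le_abs_self M]

/-! ### The quantile function of the log-normal law -/

instance (m : ℝ) (v : ℝ≥0) : IsProbabilityMeasure (logNormal m v) :=
  Measure.isProbabilityMeasure_map Real.measurable_exp.aemeasurable

lemma cdf_logNormal_of_nonpos (m : ℝ) (v : ℝ≥0) {x : ℝ} (hx : x ≤ 0) :
    cdf (logNormal m v) x = 0 := by
  rw [cdf_eq_real, logNormal, map_measureReal_apply Real.measurable_exp measurableSet_Iic]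
  convert measureReal_empty
  ext y
  simpa using lt_of_le_of_lt hx (Real.exp_pos y)

lemma cdf_logNormal (m : ℝ) (v : ℝ≥0) {x : ℝ} (hx : 0 < x) :
    cdf (logNormal m v) x = cdf (gaussianReal m v) (Real.log x) := by
  rw [cdf_eq_real, cdf_eq_real, logNormal,
    map_measureReal_apply Real.measurable_exp measurableSet_Iic]
  congr 1
  ext y
  simp only [mem_preimage, mem_Iic]
  exact (Real.le_log_iff_exp_le hx).symm

lemma strictMono_cdf_gaussianReal (m : ℝ) {v : ℝ≥0} (hv : v ≠ 0) :
    StrictMono (cdf (gaussianReal m v)) := by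
  intro x y hxy
  have h : gaussianReal m v (Ioc x y) ≠ 0 := fun h => by
    have h0 := gaussianReal_absolutelyContinuous' m hv h
    rw [Real.volume_Ioc, ENNReal.ofReal_eq_zero] at h0
    linarith
  have h2 : gaussianReal m v (Ioc x y) = ENNReal.ofReal
      (cdf (gaussianReal m v) y - cdf (gaussianReal m v) x) := by
    conv_lhs => rw [← measure_cdf (gaussianReal m v)]
    rw [StieltjesFunction.measure_Ioc]
  rw [h2] at h
  simpa using h

lemma continuous_cdf_gaussianReal (m : ℝ) {v : ℝ≥0} (hv : v ≠ 0) :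
    Continuous (cdf (gaussianReal m v)) := by
  have := nullSingletonClass_gaussianReal (μ := m) hv
  rw [continuous_iff_continuousAt]
  intro x
  rw [(monotone_cdf _).continuousAt_iff_leftLim_eq_rightLim, StieltjesFunction.rightLim_eq]
  have h : gaussianReal m v {x} = 0 := measure_singleton x
  rw [← measure_cdf (gaussianReal m v), StieltjesFunction.measure_singleton,
    ENNReal.ofReal_eq_zero] at h
  exact le_antisymm ((monotone_cdf _).leftLim_le le_rfl) (by linarith)

section LogNormal

variable {m : ℝ} {v : ℝ≥0}

lemma cdf_logNormal_lt (hv : v ≠ 0) {x y : ℝ} (hx : 0 < x) (hxy : x < y) :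
    cdf (logNormal m v) x < cdf (logNormal m v) y := by
  rw [cdf_logNormal m v hx, cdf_logNormal m v (hx.trans hxy)]
  exact strictMono_cdf_gaussianReal m hv (Real.log_lt_log hx hxy)

lemma cdf_logNormal_mem (hv : v ≠ 0) {x : ℝ} (hx : 0 < x) :
    cdf (logNormal m v) x ∈ Ioo (0 : ℝ) 1 := by
  refine ⟨lt_of_le_of_lt (cdf_nonneg _ (x / 2)) (cdf_logNormal_lt hv (half_pos hx) (by linarith)),
    lt_of_lt_of_le (cdf_logNormal_lt hv hx (lt_add_one x)) (cdf_le_one _ _)⟩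

lemma exists_cdf_logNormal_eq (hv : v ≠ 0) {p : ℝ} (hp : p ∈ Ioo (0 : ℝ) 1) :
    ∃ x, 0 < x ∧ cdf (logNormal m v) x = p := by
  obtain ⟨a, ha⟩ := ((tendsto_cdf_atBot (gaussianReal m v)).eventually_lt_const hp.1).exists
  obtain ⟨b, hb⟩ := ((tendsto_cdf_atTop (gaussianReal m v)).eventually_const_lt hp.2).exists
  obtain ⟨t, ht⟩ := mem_range_of_exists_le_of_exists_ge (continuous_cdf_gaussianReal m hv)
    ⟨a, ha.le⟩ ⟨b, hb.le⟩
  exact ⟨Real.exp t, Real.exp_pos t, by rw [cdf_logNormal m v (Real.exp_pos t), Real.log_exp, ht]⟩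

lemma quantile_cdf_logNormal (hv : v ≠ 0) {x : ℝ} (hx : 0 < x) :
    quantile (logNormal m v) (cdf (logNormal m v) x) = x := by
  have : {y : ℝ | cdf (logNormal m v) x ≤ cdf (logNormal m v) y} = Ici x := by
    ext y
    simp only [mem_ofPred_eq, mem_Ici]
    refine ⟨fun h => ?_, fun h => monotone_cdf _ h⟩
    by_contra! hlt
    rcases le_or_gt y 0 with hy | hy
    · rw [cdf_logNormal_of_nonpos m v hy] at h
      exact absurd (cdf_logNormal_mem (m := m) hv hx).1 (not_lt.2 h)
    · exact absurd (cdf_logNormal_lt (m := m) hv hy hlt) (not_lt.2 h)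
  rw [quantile, this, csInf_Ici]

lemma cdf_quantile_logNormal (hv : v ≠ 0) {p : ℝ} (hp : p ∈ Ioo (0 : ℝ) 1) :
    cdf (logNormal m v) (quantile (logNormal m v) p) = p := by
  obtain ⟨x, hx, rfl⟩ := exists_cdf_logNormal_eq (m := m) hv hp
  rw [quantile_cdf_logNormal hv hx]

lemma quantile_logNormal_pos (hv : v ≠ 0) {p : ℝ} (hp : p ∈ Ioo (0 : ℝ) 1) :
    0 < quantile (logNormal m v) p := by
  obtain ⟨x, hx, rfl⟩ := exists_cdf_logNormal_eq (m := m) hv hp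
  rwa [quantile_cdf_logNormal hv hx]

end LogNormal

/-- The properties of `z ↦ F⁻¹(1 - z)` on which the analysis of the multipliers rests. -/
structure IsKernel (q : ℝ → ℝ) : Prop where
  strictAntiOn : StrictAntiOn q (Ioo 0 1)
  image_eq : q '' Ioo 0 1 = Ioi 0
  integrableOn : IntegrableOn q (Ioo 0 1)

lemma strictAntiOn_quantile_logNormal {m : ℝ} {v : ℝ≥0} (hv : v ≠ 0) :
    StrictAntiOn (fun z => quantile (logNormal m v) (1 - z)) (Ioo 0 1) := by
  intro x hx y hy hxy
  have hx' : 1 - x ∈ Ioo (0 : ℝ) 1 := ⟨by linarith [hx.2], by linarith [hx.1]⟩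
  have hy' : 1 - y ∈ Ioo (0 : ℝ) 1 := ⟨by linarith [hy.2], by linarith [hy.1]⟩
  by_contra! h
  have := monotone_cdf (logNormal m v) h
  simp only [cdf_quantile_logNormal hv hx', cdf_quantile_logNormal hv hy'] at this
  linarith

lemma image_quantile_logNormal {m : ℝ} {v : ℝ≥0} (hv : v ≠ 0) :
    (fun z => quantile (logNormal m v) (1 - z)) '' Ioo 0 1 = Ioi 0 := by
  apply Subset.antisymm
  · rintro _ ⟨z, hz, rfl⟩
    exact quantile_logNormal_pos hv ⟨by linarith [hz.2], by linarith [hz.1]⟩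
  · intro x hx
    have h := cdf_logNormal_mem (m := m) hv (mem_Ioi.1 hx)
    exact ⟨1 - cdf (logNormal m v) x, ⟨by linarith [h.2], by linarith [h.1]⟩,
      by simp only [sub_sub_cancel, quantile_cdf_logNormal hv (mem_Ioi.1 hx)]⟩

lemma aemeasurable_quantile_logNormal {m : ℝ} {v : ℝ≥0} (hv : v ≠ 0) :
    AEMeasurable (fun z => quantile (logNormal m v) (1 - z)) (volume.restrict (Ioo 0 1)) :=
  aemeasurable_restrict_of_antitoneOn measurableSet_Ioo
    (strictAntiOn_quantile_logNormal hv).antitoneOn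

/-- Under the uniform law on `(0, 1)` the function `z ↦ F⁻¹(1 - z)` has the distribution
function `F`. -/
lemma map_quantile_logNormal {m : ℝ} {v : ℝ≥0} (hv : v ≠ 0) :
    (volume.restrict (Ioo (0 : ℝ) 1)).map (fun z => quantile (logNormal m v) (1 - z))
      = logNormal m v := by
  have hm := aemeasurable_quantile_logNormal (m := m) hv
  have hprob : IsProbabilityMeasure (volume.restrict (Ioo (0 : ℝ) 1)) := ⟨by simp⟩
  have := Measure.isProbabilityMeasure_map hm
  refine Measure.eq_of_cdf _ _ ?_
  ext x
  rw [cdf_eq_real, measureReal_def, Measure.map_apply_of_aemeasurable hm measurableSet_Iic]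
  have hset : ∀ z ∈ Ioo (0 : ℝ) 1,
      (quantile (logNormal m v) (1 - z) ≤ x ↔ 1 - cdf (logNormal m v) x ≤ z) := by
    intro z hz
    have hz' : 1 - z ∈ Ioo (0 : ℝ) 1 := ⟨by linarith [hz.2], by linarith [hz.1]⟩
    constructor
    · intro h
      have := monotone_cdf (logNormal m v) h
      rw [cdf_quantile_logNormal hv hz'] at this
      linarith
    · intro h
      by_contra! hlt
      rcases le_or_gt x 0 with hx | hx
      · rw [cdf_logNormal_of_nonpos m v hx] at h
        linarith [hz.2]
      · have := cdf_logNormal_lt (m := m) hv hx hlt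
        rw [cdf_quantile_logNormal hv hz'] at this
        linarith
  have h1 : (volume.restrict (Ioo (0 : ℝ) 1))
      ((fun z => quantile (logNormal m v) (1 - z)) ⁻¹' Iic x)
      = volume.restrict (Ioo (0 : ℝ) 1) (Ici (1 - cdf (logNormal m v) x)) := by
    apply measure_congr
    filter_upwards [ae_restrict_mem measurableSet_Ioo] with z hz
    exact propext (hset z hz)
  rw [h1, Measure.restrict_apply measurableSet_Ici]
  have h0 := cdf_nonneg (logNormal m v) x
  have h0' := cdf_le_one (logNormal m v) x
  have h2 : volume (Ici (1 - cdf (logNormal m v) x) ∩ Ioo (0 : ℝ) 1)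
      = volume (Ioo (1 - cdf (logNormal m v) x) 1) := by
    apply measure_congr
    have : (Ici (1 - cdf (logNormal m v) x) : Set ℝ) =ᵐ[volume]
      Ioi (1 - cdf (logNormal m v) x) := Ioi_ae_eq_Ici.symm
    refine (this.inter (ae_eq_refl _)).trans ?_
    apply Eventually.of_forall
    intro z
    apply propext
    change (_ < z ∧ (0 < z ∧ z < 1)) ↔ (_ < z ∧ z < 1)
    constructor
    · exact fun h => ⟨h.1, h.2.2⟩
    · exact fun h => ⟨h.1, by linarith [h.1], h.2⟩
  rw [h2, Real.volume_Ioo, sub_sub_cancel, ENNReal.toReal_ofReal h0]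

lemma integrable_id_logNormal (m : ℝ) (v : ℝ≥0) : Integrable id (logNormal m v) := by
  rw [logNormal, integrable_map_measure measurable_id.aestronglyMeasurable
    Real.measurable_exp.aemeasurable]
  simpa [Function.comp_def] using integrable_exp_mul_gaussianReal (μ := m) (v := v) 1

lemma isKernel_quantile_logNormal {m : ℝ} {v : ℝ≥0} (hv : v ≠ 0) :
    IsKernel fun z => quantile (logNormal m v) (1 - z) where
  strictAntiOn := strictAntiOn_quantile_logNormal hv
  image_eq := image_quantile_logNormal hv
  integrableOn := by
    have h := integrable_id_logNormal m v
    rw [← map_quantile_logNormal hv, integrable_map_measure measurable_id.aestronglyMeasurable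
      (aemeasurable_quantile_logNormal hv)] at h
    exact h

/-! ### Integrals depending on a parameter, and roots of monotone families -/

lemma setIntegral_lt_setIntegral {f g : ℝ → ℝ} {s : Set ℝ} (hs : MeasurableSet s)
    (hf : IntegrableOn f s) (hg : IntegrableOn g s) (hle : ∀ x ∈ s, f x ≤ g x) {a b : ℝ}
    (hab : a < b) (hsub : Ioo a b ⊆ s) (hlt : ∀ x ∈ Ioo a b, f x < g x) :
    ∫ x in s, f x < ∫ x in s, g x := by
  refine lt_of_le_of_ne (setIntegral_mono_on hf hg hs hle) fun heq => ?_
  have hae : ∀ᵐ x ∂volume.restrict s, f x ≤ g x := by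
    filter_upwards [ae_restrict_mem hs] with x hx using hle x hx
  rw [integral_eq_iff_of_ae_le hf hg hae] at heq
  have h2 : ∀ᵐ x ∂volume.restrict (Ioo a b), f x = g x :=
    ae_mono (Measure.restrict_mono_set _ hsub) heq
  have hne : (ae (volume.restrict (Ioo a b))).NeBot := by
    rw [ae_neBot, Ne, Measure.restrict_eq_zero, Real.volume_Ioo, ENNReal.ofReal_eq_zero]
    linarith
  obtain ⟨x, hx, hx'⟩ := (h2.and (ae_restrict_mem measurableSet_Ioo)).exists
  exact (hlt x hx').ne hx

lemma continuous_setIntegral_max_add {f : ℝ → ℝ} {s : Set ℝ} (hs : volume s ≠ ⊤)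
    (hf : IntegrableOn f s) : Continuous fun t => ∫ z in s, max (f z + t) 0 := by
  have : IsFiniteMeasure (volume.restrict s) := ⟨by simpa using hs.lt_top⟩
  rw [continuous_iff_continuousAt]
  intro t₀
  refine continuousAt_of_dominated (bound := fun z => |f z| + (|t₀| + 1)) ?_ ?_ ?_ ?_
  · exact Eventually.of_forall fun t => (hf.add (integrable_const t)).pos_part.aestronglyMeasurable
  · filter_upwards [Metric.ball_mem_nhds t₀ one_pos] with t ht
    refine Eventually.of_forall fun z => ?_
    rw [Metric.mem_ball, Real.dist_eq] at ht
    rw [Real.norm_eq_abs, abs_of_nonneg (le_max_right _ _)]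
    refine max_le ?_ (by positivity)
    have := abs_sub_abs_le_abs_sub t t₀
    linarith [le_abs_self (f z), le_abs_self t]
  · exact hf.abs.add (integrable_const _)
  · exact Eventually.of_forall fun z => by fun_prop

/-- The root `r c` of a function `f c` which changes sign only there depends continuously on `c`. -/
lemma continuousOn_root {S J : Set ℝ} {f : ℝ → ℝ → ℝ} {r : ℝ → ℝ} (hJ : OrdConnected J)
    (hr : ∀ c ∈ S, r c ∈ J) (hcont : ∀ x ∈ J, ContinuousOn (fun c => f c x) S)
    (hneg : ∀ c ∈ S, ∀ x ∈ J, x < r c → f c x < 0)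
    (hpos : ∀ c ∈ S, ∀ x ∈ J, r c < x → 0 < f c x) (hroot : ∀ c ∈ S, f c (r c) = 0) :
    ContinuousOn r S := by
  intro c₀ h₀
  refine tendsto_order.2 ⟨fun x hx => ?_, fun x hx => ?_⟩
  · by_cases hxJ : x ∈ J
    · filter_upwards [(hcont x hxJ c₀ h₀).eventually_lt_const (hneg c₀ h₀ x hxJ hx),
        self_mem_nhdsWithin] with c hc hcS
      by_contra! hle
      rcases hle.lt_or_eq with h | h
      · exact (hpos c hcS x hxJ h).not_gt hc
      · exact hc.ne (h ▸ hroot c hcS)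
    · filter_upwards [self_mem_nhdsWithin] with c hcS
      by_contra! hle
      exact hxJ (hJ.out (hr c hcS) (hr c₀ h₀) ⟨hle, hx.le⟩)
  · by_cases hxJ : x ∈ J
    · filter_upwards [(hcont x hxJ c₀ h₀).eventually_const_lt (hpos c₀ h₀ x hxJ hx),
        self_mem_nhdsWithin] with c hc hcS
      by_contra! hle
      rcases hle.lt_or_eq with h | h
      · exact (hneg c hcS x hxJ h).not_gt hc
      · exact hc.ne' (h ▸ hroot c hcS)
    · filter_upwards [self_mem_nhdsWithin] with c hcS
      by_contra! hle
      exact hxJ (hJ.out (hr c₀ h₀) (hr c hcS) ⟨hx.le, hle⟩)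

/-! ### The tangency curve -/

section Kernel

variable {q : ℝ → ℝ} {α : ℝ}

lemma IsKernel.pos (hq : IsKernel q) {z : ℝ} (hz : z ∈ Ioo (0 : ℝ) 1) : 0 < q z :=
  hq.image_eq.subset (mem_image_of_mem q hz)

lemma IsKernel.exists_eq (hq : IsKernel q) {x : ℝ} (hx : 0 < x) : ∃ z ∈ Ioo (0 : ℝ) 1, q z = x :=
  hq.image_eq.symm.subset hx

lemma IsKernel.continuousOn (hq : IsKernel q) : ContinuousOn q (Ioo 0 1) := fun _ hz =>
  (continuousAt_of_strictAntiOn_of_image_mem_nhds hq.strictAntiOn (isOpen_Ioo.mem_nhds hz)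
    (by rw [hq.image_eq]
        exact Ioi_mem_nhds (hq.pos hz))).continuousWithinAt

lemma Ioo_zero_subset (hα : α ∈ Ioo (0 : ℝ) 1) : Ioo 0 α ⊆ Ioo (0 : ℝ) 1 :=
  Ioo_subset_Ioo_right hα.2.le

lemma Ioo_one_subset (hα : α ∈ Ioo (0 : ℝ) 1) : Ioo α 1 ⊆ Ioo (0 : ℝ) 1 :=
  Ioo_subset_Ioo_left hα.1.le

/-- The left side `∫₀^α (b - q)⁺` of the tangency equation. -/
noncomputable def lowerGap (q : ℝ → ℝ) (α b : ℝ) : ℝ := ∫ z in Ioo 0 α, max (b - q z) 0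

/-- The right side `∫_α¹ (q - c)⁺` of the tangency equation. -/
noncomputable def upperGap (q : ℝ → ℝ) (α c : ℝ) : ℝ := ∫ z in Ioo α 1, max (q z - c) 0

lemma IsKernel.integrableOn_lower (hq : IsKernel q) (hα : α ∈ Ioo (0 : ℝ) 1) (b : ℝ) :
    IntegrableOn (fun z => max (b - q z) 0) (Ioo 0 α) :=
  ((integrable_const b).sub (hq.integrableOn.mono_set (Ioo_zero_subset hα))).pos_part

lemma IsKernel.integrableOn_upper (hq : IsKernel q) (hα : α ∈ Ioo (0 : ℝ) 1) (c : ℝ) :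
    IntegrableOn (fun z => max (q z - c) 0) (Ioo α 1) :=
  ((hq.integrableOn.mono_set (Ioo_one_subset hα)).sub (integrable_const c)).pos_part

lemma IsKernel.continuous_lowerGap (hq : IsKernel q) (hα : α ∈ Ioo (0 : ℝ) 1) :
    Continuous (lowerGap q α) := by
  have h := continuous_setIntegral_max_add (f := fun z => -q z) (s := Ioo 0 α) (by simp)
    (hq.integrableOn.mono_set (Ioo_zero_subset hα)).neg
  simp only [neg_add_eq_sub] at h
  exact h

lemma IsKernel.continuous_upperGap (hq : IsKernel q) (hα : α ∈ Ioo (0 : ℝ) 1) :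
    Continuous (upperGap q α) := by
  have h := (continuous_setIntegral_max_add (f := q) (s := Ioo α 1) (by simp)
    (hq.integrableOn.mono_set (Ioo_one_subset hα))).comp continuous_neg
  exact h

lemma IsKernel.lowerGap_mono (hq : IsKernel q) (hα : α ∈ Ioo (0 : ℝ) 1) :
    Monotone (lowerGap q α) := fun _ _ h =>
  setIntegral_mono_on (hq.integrableOn_lower hα _) (hq.integrableOn_lower hα _) measurableSet_Ioo
    fun _ _ => max_le_max_right _ (sub_le_sub_right h _)

lemma IsKernel.lowerGap_lt (hq : IsKernel q) (hα : α ∈ Ioo (0 : ℝ) 1) {b b' : ℝ} (hb : q α ≤ b)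
    (hbb : b < b') : lowerGap q α b < lowerGap q α b' := by
  obtain ⟨w, hw, rfl⟩ := hq.exists_eq ((hq.pos hα).trans_le (hb.trans hbb.le))
  have hwα : w < α := (hq.strictAntiOn.lt_iff_gt hα hw).1 (hb.trans_lt hbb)
  refine setIntegral_lt_setIntegral measurableSet_Ioo (hq.integrableOn_lower hα _)
    (hq.integrableOn_lower hα _) (fun _ _ => max_le_max_right _ (sub_le_sub_right hbb.le _)) hwα
    (Ioo_subset_Ioo_left hw.1.le) fun z hz => ?_
  have : q z < q w := hq.strictAntiOn hw ⟨hw.1.trans hz.1, hz.2.trans hα.2⟩ hz.1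
  exact lt_of_lt_of_le (max_lt (by linarith) (by linarith)) (le_max_left _ _)

lemma IsKernel.upperGap_lt (hq : IsKernel q) (hα : α ∈ Ioo (0 : ℝ) 1) {c c' : ℝ} (hc : 0 ≤ c)
    (hcc : c < c') (hc' : c' ≤ q α) : upperGap q α c' < upperGap q α c := by
  obtain ⟨w, hw, hqw⟩ := hq.exists_eq (x := (c + c') / 2) (by linarith)
  have hwα : α < w := (hq.strictAntiOn.lt_iff_gt hw hα).1 (by linarith)
  refine setIntegral_lt_setIntegral measurableSet_Ioo (hq.integrableOn_upper hα _)
    (hq.integrableOn_upper hα _) (fun _ _ => max_le_max_right _ (sub_le_sub_left hcc.le _)) hwα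
    (Ioo_subset_Ioo_right hw.2.le) fun z hz => ?_
  have : q w < q z := hq.strictAntiOn ⟨hα.1.trans hz.1, hz.2.trans hw.2⟩ hw hz.2
  exact lt_of_lt_of_le (max_lt (by linarith) (by linarith)) (le_max_left _ _)

lemma IsKernel.lowerGap_self (hq : IsKernel q) (hα : α ∈ Ioo (0 : ℝ) 1) {b : ℝ} (hb : b ≤ q α) :
    lowerGap q α b = 0 := by
  rw [lowerGap, setIntegral_congr_fun (g := fun _ => 0) measurableSet_Ioo, integral_zero]
  intro z hz
  have : q α < q z := hq.strictAntiOn (Ioo_zero_subset hα hz) hα hz.2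
  exact max_eq_right (by linarith)

lemma IsKernel.upperGap_self (hq : IsKernel q) (hα : α ∈ Ioo (0 : ℝ) 1) :
    upperGap q α (q α) = 0 := by
  rw [upperGap, setIntegral_congr_fun (g := fun _ => 0) measurableSet_Ioo, integral_zero]
  intro z hz
  have : q z < q α := hq.strictAntiOn hα (Ioo_one_subset hα hz) hz.1
  exact max_eq_right (by linarith)

lemma upperGap_nonneg (q : ℝ → ℝ) (α c : ℝ) : 0 ≤ upperGap q α c :=
  integral_nonneg fun _ => le_max_right _ _

/-- The curve `c ↦ b c` of pairs `(b, c)` for which the line of slope `c` is tangent to `φ_λ` at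
`z₂` with `q z₂ = c` and at `z₁` with `q z₁ = b`, where `b = c + λ / α`. The end points `c = 0` and
`c = q α` correspond to `λ = λ̂` and `λ = 0`. -/
structure IsTangency (q : ℝ → ℝ) (α : ℝ) (b : ℝ → ℝ) : Prop where
  le : ∀ c ∈ Icc 0 (q α), q α ≤ b c
  eq : ∀ c ∈ Icc 0 (q α), lowerGap q α (b c) = upperGap q α c

lemma IsKernel.exists_isTangency (hq : IsKernel q) (hα : α ∈ Ioo (0 : ℝ) 1) :
    ∃ b, IsTangency q α b := by
  have key : ∀ c, ∃ b, q α ≤ b ∧ lowerGap q α b = upperGap q α c := by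
    intro c
    set B := max (q α) ((upperGap q α c + ∫ z in Ioo 0 α, q z) / α) with hB
    have hBK : upperGap q α c ≤ lowerGap q α B := by
      have h1 : ∫ z in Ioo 0 α, (B - q z) ≤ lowerGap q α B :=
        setIntegral_mono_on
          ((integrable_const B).sub (hq.integrableOn.mono_set (Ioo_zero_subset hα)))
          (hq.integrableOn_lower hα _) measurableSet_Ioo fun _ _ => le_max_left _ _
      rw [integral_sub (integrable_const B) (hq.integrableOn.mono_set (Ioo_zero_subset hα)),
        integral_const, measureReal_restrict_apply_univ, Real.volume_real_Ioo_of_le hα.1.le,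
        sub_zero, smul_eq_mul] at h1
      have h2 : (upperGap q α c + ∫ z in Ioo 0 α, q z) / α ≤ B := le_max_right _ _
      rw [div_le_iff₀ hα.1] at h2
      linarith
    obtain ⟨b, hb, hb'⟩ := intermediate_value_Icc (le_max_left _ _ : q α ≤ B)
      (hq.continuous_lowerGap hα).continuousOn
      ⟨(hq.lowerGap_self hα le_rfl).trans_le (upperGap_nonneg q α c), hBK⟩
    exact ⟨b, hb.1, hb'⟩
  choose b hb using key
  exact ⟨b, fun c _ => (hb c).1, fun c _ => (hb c).2⟩

variable {b : ℝ → ℝ}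

lemma IsTangency.lt_of_lt (hb : IsTangency q α b) (hq : IsKernel q) (hα : α ∈ Ioo (0 : ℝ) 1)
    {c c' : ℝ} (hc : 0 ≤ c) (hcc : c < c') (hc' : c' ≤ q α) : b c' < b c := by
  have h := hq.upperGap_lt hα hc hcc hc'
  rw [← hb.eq c ⟨hc, hcc.le.trans hc'⟩, ← hb.eq c' ⟨hc.trans hcc.le, hc'⟩] at h
  exact (hq.lowerGap_mono hα).reflect_lt h

lemma IsTangency.antitoneOn (hb : IsTangency q α b) (hq : IsKernel q) (hα : α ∈ Ioo (0 : ℝ) 1) :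
    AntitoneOn b (Icc 0 (q α)) := fun c hc c' hc' h => by
  rcases h.lt_or_eq with h | h
  · exact (hb.lt_of_lt hq hα hc.1 h hc'.2).le
  · rw [h]

lemma IsTangency.apply_self (hb : IsTangency q α b) (hq : IsKernel q) (hα : α ∈ Ioo (0 : ℝ) 1) :
    b (q α) = q α := by
  have hm : q α ∈ Icc 0 (q α) := ⟨(hq.pos hα).le, le_rfl⟩
  refine le_antisymm ?_ (hb.le _ hm)
  by_contra! h
  have := hq.lowerGap_lt hα le_rfl h
  rw [hb.eq _ hm, hq.upperGap_self hα, hq.lowerGap_self hα le_rfl] at this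
  exact this.false

lemma IsTangency.continuousOn (hb : IsTangency q α b) (hq : IsKernel q)
    (hα : α ∈ Ioo (0 : ℝ) 1) : ContinuousOn b (Icc 0 (q α)) := by
  refine continuousOn_root (J := Ici (q α)) (f := fun c x => lowerGap q α x - upperGap q α c)
    ordConnected_Ici hb.le ?_ ?_ ?_ ?_
  · exact fun x _ => (continuous_const.sub (hq.continuous_upperGap hα)).continuousOn
  · intro c hc x hx hlt
    rw [← hb.eq c hc, sub_neg]
    exact hq.lowerGap_lt hα hx hlt
  · intro c hc x _ hlt
    rw [← hb.eq c hc, sub_pos]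
    exact hq.lowerGap_lt hα (hb.le c hc) hlt
  · intro c hc
    rw [hb.eq c hc, sub_self]

end Kernel

/-! ### The multiplier of the budget constraint -/

section Price

variable {q p W : ℝ → ℝ} {α : ℝ}

/-- Positive decreasing price densities below `q`. -/
structure IsPrice (q p : ℝ → ℝ) : Prop where
  antitoneOn : AntitoneOn p (Ioo 0 1)
  pos : ∀ z ∈ Ioo (0 : ℝ) 1, 0 < p z
  le : ∀ z ∈ Ioo (0 : ℝ) 1, p z ≤ q z

lemma IsKernel.isPrice (hq : IsKernel q) : IsPrice q q :=
  ⟨hq.strictAntiOn.antitoneOn, fun _ hz => hq.pos hz, fun _ _ => le_rfl⟩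

lemma IsDemand.monotoneOn_comp (hW : IsDemand W) {r : ℝ → ℝ} {s : Set ℝ} (hr : AntitoneOn r s)
    (hpos : ∀ z ∈ s, 0 < r z) : MonotoneOn (fun z => W (r z)) s := fun x hx y hy hxy =>
  hW.antitoneOn (hpos y hy) (hpos x hx) (hr hx hy hxy)

lemma IsPrice.monotoneOn_demand (hp : IsPrice q p) (hW : IsDemand W) {ν : ℝ} (hν : 0 < ν) :
    MonotoneOn (fun z => W (ν * p z)) (Ioo 0 1) :=
  hW.monotoneOn_comp
    (fun _ hx _ hy hxy => mul_le_mul_of_nonneg_left (hp.antitoneOn hx hy hxy) hν.le)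
    fun z hz => mul_pos hν (hp.pos z hz)

lemma integrableOn_of_monotoneOn {f : ℝ → ℝ} (hα : α ∈ Ioo (0 : ℝ) 1)
    (hf : MonotoneOn f (Ioo 0 1)) (hf0 : ∀ z ∈ Ioo (0 : ℝ) 1, 0 ≤ f z) :
    IntegrableOn f (Ioo 0 α) := by
  refine (integrable_const (f α)).mono' (aemeasurable_restrict_of_monotoneOn measurableSet_Ioo
    (hf.mono (Ioo_zero_subset hα))).aestronglyMeasurable ?_
  filter_upwards [ae_restrict_mem measurableSet_Ioo] with z hz
  rw [Real.norm_eq_abs, abs_of_nonneg (hf0 z (Ioo_zero_subset hα hz))]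
  exact hf (Ioo_zero_subset hα hz) hα hz.2.le

/-- `α` times the left tail average at level `α` of the demand at the prices `ν p`. -/
noncomputable def tailDemand (W : ℝ → ℝ) (α : ℝ) (p : ℝ → ℝ) (ν : ℝ) : ℝ :=
  ∫ z in Ioo 0 α, W (ν * p z)

lemma IsPrice.integrableOn_demand (hp : IsPrice q p) (hW : IsDemand W) (hα : α ∈ Ioo (0 : ℝ) 1)
    {ν : ℝ} (hν : 0 < ν) : IntegrableOn (fun z => W (ν * p z)) (Ioo 0 α) :=
  integrableOn_of_monotoneOn hα (hp.monotoneOn_demand hW hν) fun _ _ => hW.nonneg _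

lemma IsPrice.tailDemand_anti (hp : IsPrice q p) (hW : IsDemand W) (hα : α ∈ Ioo (0 : ℝ) 1)
    {ν ν' : ℝ} (hν : 0 < ν) (h : ν ≤ ν') : tailDemand W α p ν' ≤ tailDemand W α p ν := by
  refine setIntegral_mono_on (hp.integrableOn_demand hW hα (hν.trans_le h))
    (hp.integrableOn_demand hW hα hν) measurableSet_Ioo fun z hz => ?_
  have hz' := hp.pos z (Ioo_zero_subset hα hz)
  exact hW.antitoneOn (mul_pos hν hz') (mul_pos (hν.trans_le h) hz')
    (mul_le_mul_of_nonneg_right h hz'.le)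

lemma IsPrice.tailDemand_lt (hp : IsPrice q p) (hW : IsDemand W) (hα : α ∈ Ioo (0 : ℝ) 1)
    {ν ν' : ℝ} (hν : 0 < ν) (h : ν < ν') (hpos : 0 < tailDemand W α p ν) :
    tailDemand W α p ν' < tailDemand W α p ν := by
  refine lt_of_le_of_ne (hp.tailDemand_anti hW hα hν h.le) fun heq => ?_
  have hi := hp.integrableOn_demand hW hα hν
  have hi' := hp.integrableOn_demand hW hα (hν.trans h)
  have hle : ∀ᵐ z ∂volume.restrict (Ioo 0 α), W (ν' * p z) ≤ W (ν * p z) := by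
    filter_upwards [ae_restrict_mem measurableSet_Ioo] with z hz
    have hz' := hp.pos z (Ioo_zero_subset hα hz)
    exact hW.antitoneOn (mul_pos hν hz') (mul_pos (hν.trans h) hz')
      (mul_le_mul_of_nonneg_right h.le hz'.le)
  have hae := (integral_eq_iff_of_ae_le hi' hi hle).1 heq
  have h0 : tailDemand W α p ν = 0 := by
    refine integral_eq_zero_of_ae ?_
    filter_upwards [hae, ae_restrict_mem measurableSet_Ioo] with z hz hz1
    have hz' := hp.pos z (Ioo_zero_subset hα hz1)
    by_contra hne
    exact (hW.lt_of_pos _ _ (mul_pos hν hz') (mul_lt_mul_of_pos_right h hz')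
      (lt_of_le_of_ne (hW.nonneg _) (Ne.symm hne))).ne hz
  exact hpos.ne' h0

lemma IsPrice.tailDemand_le_of_price_le {p' : ℝ → ℝ} (hp : IsPrice q p) (hp' : IsPrice q p')
    (hW : IsDemand W) (hα : α ∈ Ioo (0 : ℝ) 1) (hle : ∀ z ∈ Ioo (0 : ℝ) 1, p z ≤ p' z) {ν : ℝ}
    (hν : 0 < ν) : tailDemand W α p' ν ≤ tailDemand W α p ν := by
  refine setIntegral_mono_on (hp'.integrableOn_demand hW hα hν)
    (hp.integrableOn_demand hW hα hν) measurableSet_Ioo fun z hz => ?_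
  have hz1 := Ioo_zero_subset hα hz
  exact hW.antitoneOn (mul_pos hν (hp.pos z hz1)) (mul_pos hν (hp'.pos z hz1))
    (mul_le_mul_of_nonneg_left (hle z hz1) hν.le)

/-- Dominated convergence for the tail demand, along prices bounded away from zero. -/
lemma IsDemand.tendsto_integral (hW : IsDemand W) {l : Filter ℝ} [l.IsCountablyGenerated]
    {r : ℝ → ℝ → ℝ} {r₀ : ℝ → ℝ} {ε : ℝ} (hε : 0 < ε)
    (hanti : ∀ᶠ i in l, AntitoneOn (r i) (Ioo 0 α))
    (hr : ∀ᶠ i in l, ∀ z ∈ Ioo 0 α, ε ≤ r i z) (hr₀ : ∀ z ∈ Ioo 0 α, 0 < r₀ z)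
    (hlim : ∀ z ∈ Ioo 0 α, Tendsto (fun i => r i z) l (𝓝 (r₀ z))) :
    Tendsto (fun i => ∫ z in Ioo 0 α, W (r i z)) l (𝓝 (∫ z in Ioo 0 α, W (r₀ z))) := by
  refine tendsto_integral_filter_of_dominated_convergence (fun _ => W ε) ?_ ?_
    (integrable_const _) ?_
  · filter_upwards [hanti, hr] with i hi hri
    exact (aemeasurable_restrict_of_monotoneOn measurableSet_Ioo
      (hW.monotoneOn_comp hi fun z hz => hε.trans_le (hri z hz))).aestronglyMeasurable
  · filter_upwards [hr] with i hri
    filter_upwards [ae_restrict_mem measurableSet_Ioo] with z hz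
    rw [Real.norm_eq_abs, abs_of_nonneg (hW.nonneg _)]
    exact hW.antitoneOn hε (hε.trans_le (hri z hz)) (hri z hz)
  · filter_upwards [ae_restrict_mem measurableSet_Ioo] with z hz
    exact (hW.continuousOn.continuousAt (Ioi_mem_nhds (hr₀ z hz))).tendsto.comp (hlim z hz)

lemma IsPrice.continuousOn_tailDemand (hp : IsPrice q p) (hW : IsDemand W)
    (hα : α ∈ Ioo (0 : ℝ) 1) : ContinuousOn (tailDemand W α p) (Ioi 0) := by
  intro ν₀ hν₀
  have hν₀' : 0 < ν₀ := hν₀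
  have hpα := hp.pos α hα
  refine ContinuousAt.continuousWithinAt ?_
  have hev : ∀ᶠ ν in 𝓝 ν₀, ν₀ / 2 < ν := eventually_gt_nhds (by linarith)
  refine hW.tendsto_integral (ε := ν₀ / 2 * p α) (by positivity) ?_ ?_ ?_ ?_
  · filter_upwards [hev] with ν hν x hx y hy hxy
    exact mul_le_mul_of_nonneg_left
      (hp.antitoneOn (Ioo_zero_subset hα hx) (Ioo_zero_subset hα hy) hxy) (by linarith)
  · filter_upwards [hev] with ν hν z hz
    exact mul_le_mul hν.le (hp.antitoneOn (Ioo_zero_subset hα hz) hα hz.2.le) hpα.le (by linarith)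
  · exact fun z hz => mul_pos hν₀ (hp.pos z (Ioo_zero_subset hα hz))
  · exact fun z _ => tendsto_id.mul_const _

lemma IsPrice.exists_tailDemand_eq (hp : IsPrice q p) (hq : IsKernel q) (hW : IsDemand W)
    (hα : α ∈ Ioo (0 : ℝ) 1) {t : ℝ} (ht : 0 < t) : ∃ ν, 0 < ν ∧ tailDemand W α p ν = t := by
  have hα0 := hα.1
  have hpα := hp.pos α hα
  have hα2 : α / 2 ∈ Ioo (0 : ℝ) 1 := ⟨by linarith, by linarith [hα.2]⟩
  have hqα := hq.pos hα2
  obtain ⟨ε, hε, hWε⟩ := hW.exists_gt (2 * t / α)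
  have hν₁ : 0 < ε / q (α / 2) := by positivity
  have hlarge : t ≤ tailDemand W α p (ε / q (α / 2)) := by
    have h1 : ∫ z in Ioo (α / 2) α, W ε ≤ ∫ z in Ioo (α / 2) α, W (ε / q (α / 2) * p z) := by
      refine setIntegral_mono_on (integrable_const _)
        ((hp.integrableOn_demand hW hα hν₁).mono_set (Ioo_subset_Ioo_left hα2.1.le))
        measurableSet_Ioo fun z hz => ?_
      have hz1 : z ∈ Ioo (0 : ℝ) 1 := ⟨hα2.1.trans hz.1, hz.2.trans hα.2⟩
      refine hW.antitoneOn (mul_pos hν₁ (hp.pos z hz1)) hε ?_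
      have h2 : p z ≤ q (α / 2) :=
        (hp.le z hz1).trans (hq.strictAntiOn.antitoneOn hα2 hz1 hz.1.le)
      calc ε / q (α / 2) * p z ≤ ε / q (α / 2) * q (α / 2) := by gcongr
        _ = ε := div_mul_cancel₀ _ hqα.ne'
    have h2 : ∫ z in Ioo (α / 2) α, W (ε / q (α / 2) * p z)
        ≤ tailDemand W α p (ε / q (α / 2)) :=
      setIntegral_mono_set (hp.integrableOn_demand hW hα hν₁)
        (Eventually.of_forall fun _ => hW.nonneg _)
        (Ioo_subset_Ioo_left hα2.1.le).eventuallyLE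
    rw [integral_const, measureReal_restrict_apply_univ,
      Real.volume_real_Ioo_of_le (by linarith), smul_eq_mul] at h1
    rw [div_lt_iff₀ hα0] at hWε
    linarith
  obtain ⟨ν₂, hν₂, hWν₂⟩ : ∃ ν₂, 0 < ν₂ ∧ W (ν₂ * p α) < t := by
    have h1 : Tendsto (fun ν => W (ν * p α)) atTop (𝓝 0) :=
      hW.tendsto_top.comp (tendsto_id.atTop_mul_const hpα)
    obtain ⟨ν, h, h'⟩ := ((h1.eventually_lt_const ht).and (eventually_gt_atTop 0)).exists
    exact ⟨ν, h', h⟩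
  have hsmall : tailDemand W α p ν₂ ≤ t := by
    have h1 : tailDemand W α p ν₂ ≤ ∫ z in Ioo 0 α, W (ν₂ * p α) := by
      refine setIntegral_mono_on (hp.integrableOn_demand hW hα hν₂) (integrable_const _)
        measurableSet_Ioo fun z hz => ?_
      exact hp.monotoneOn_demand hW hν₂ (Ioo_zero_subset hα hz) hα hz.2.le
    rw [integral_const, measureReal_restrict_apply_univ,
      Real.volume_real_Ioo_of_le hα0.le, smul_eq_mul, sub_zero] at h1
    have h2 : α * W (ν₂ * p α) ≤ 1 * W (ν₂ * p α) :=
      mul_le_mul_of_nonneg_right hα.2.le (hW.nonneg _)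
    linarith
  have hsub : uIcc ν₂ (ε / q (α / 2)) ⊆ Ioi 0 := fun x hx =>
    lt_of_lt_of_le (lt_min hν₂ hν₁) hx.1
  obtain ⟨ν, hν, hν'⟩ := intermediate_value_uIcc
    ((hp.continuousOn_tailDemand hW hα).mono hsub) (Icc_subset_uIcc ⟨hsmall, hlarge⟩)
  exact ⟨ν, hsub hν, hν'⟩

end Price

/-! ### The slope of the concave envelope -/

/-- The slope of the concave envelope of `φ_λ` as a function of `x = F⁻¹(1 - z)`, where
`a = λ / α` and `c = F⁻¹(1 - z₂)`. -/
noncomputable def envelopeSlope (a c x : ℝ) : ℝ := max (x - a) (min c x)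

lemma envelopeSlope_mono (a c : ℝ) : Monotone (envelopeSlope a c) := fun _ _ h =>
  max_le_max (sub_le_sub_right h _) (min_le_min_left _ h)

lemma min_le_envelopeSlope (a c x : ℝ) : min c x ≤ envelopeSlope a c x := le_max_right _ _

lemma envelopeSlope_le {a : ℝ} (ha : 0 ≤ a) (c x : ℝ) : envelopeSlope a c x ≤ x :=
  max_le (by linarith) (min_le_right _ _)

lemma envelopeSlope_of_le {a c x : ℝ} (ha : 0 ≤ a) (h : x ≤ c) : envelopeSlope a c x = x := by
  rw [envelopeSlope, min_eq_right h, max_eq_right (by linarith)]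

lemma envelopeSlope_of_ge {a c x : ℝ} (h : c ≤ x) : envelopeSlope a c x = max (x - a) c := by
  rw [envelopeSlope, min_eq_left h]

lemma le_envelopeSlope {a c x : ℝ} (h : c ≤ x) : c ≤ envelopeSlope a c x := by
  rw [envelopeSlope_of_ge h]
  exact le_max_right _ _

lemma envelopeSlope_of_mem {a c x : ℝ} (h : c ≤ x) (h' : x ≤ c + a) :
    envelopeSlope a c x = c := by
  rw [envelopeSlope_of_ge h, max_eq_right (by linarith)]

lemma envelopeSlope_pos {a c x : ℝ} (hc : 0 < c) (hx : 0 < x) : 0 < envelopeSlope a c x :=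
  (lt_min hc hx).trans_le (min_le_envelopeSlope a c x)

section Gap

variable {q : ℝ → ℝ} {α b c : ℝ}

lemma IsKernel.isPrice_envelopeSlope (hq : IsKernel q) {a c : ℝ} (ha : 0 ≤ a) (hc : 0 < c) :
    IsPrice q fun z => envelopeSlope a c (q z) where
  antitoneOn _ hx _ hy hxy := envelopeSlope_mono a c (hq.strictAntiOn.antitoneOn hx hy hxy)
  pos _ hz := envelopeSlope_pos hc (hq.pos hz)
  le _ _ := envelopeSlope_le ha _ _

/-- The difference `φ'_λ - δ'_λ` of the slopes of `φ_λ` and of its concave envelope. -/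
noncomputable def slopeGap (q : ℝ → ℝ) (α b c z : ℝ) : ℝ :=
  if z ≤ α then -max (b - q z) 0 else max (q z - c) 0

lemma IsKernel.slopeGap_eq (hq : IsKernel q) (hα : α ∈ Ioo (0 : ℝ) 1) (hc : c ≤ q α)
    (hb : q α ≤ b) {z : ℝ} (hz : z ∈ Ioo (0 : ℝ) 1) :
    slopeGap q α b c z
      = q z - (if z ≤ α then b - c else 0) - envelopeSlope (b - c) c (q z) := by
  unfold slopeGap
  split_ifs with h
  · have h1 : q α ≤ q z := hq.strictAntiOn.antitoneOn hz hα h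
    rw [envelopeSlope_of_ge (hc.trans h1)]
    rcases le_total b (q z) with h2 | h2
    · rw [max_eq_right (by linarith), max_eq_left (by linarith)]
      ring
    · rw [max_eq_left (by linarith), max_eq_right (by linarith)]
      ring
  · have h1 : q z < q α := hq.strictAntiOn hα hz (not_le.1 h)
    rcases le_total c (q z) with h2 | h2
    · rw [envelopeSlope_of_mem h2 (by linarith), max_eq_left (by linarith)]
      ring
    · rw [envelopeSlope_of_le (by linarith) h2, max_eq_right (by linarith)]
      ring

lemma IsKernel.integrableOn_slopeGap_pieces (hq : IsKernel q) (hα : α ∈ Ioo (0 : ℝ) 1) :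
    IntegrableOn (slopeGap q α b c) (Ioc 0 α) ∧ IntegrableOn (slopeGap q α b c) (Ioo α 1) := by
  constructor
  · rw [integrableOn_Ioc_iff_integrableOn_Ioo]
    refine (hq.integrableOn_lower hα b).neg.congr_fun (fun z hz => ?_) measurableSet_Ioo
    simp [slopeGap, hz.2.le]
  · refine (hq.integrableOn_upper hα c).congr_fun (fun z hz => ?_) measurableSet_Ioo
    simp [slopeGap, hz.1]

lemma Ioc_union_Ioo_one (hα : α ∈ Ioo (0 : ℝ) 1) : Ioc 0 α ∪ Ioo α 1 = Ioo (0 : ℝ) 1 :=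
  Ioc_union_Ioo_eq_Ioo hα.1.le hα.2

lemma setIntegral_Ioo_split (hα : α ∈ Ioo (0 : ℝ) 1) {f : ℝ → ℝ} (hf : IntegrableOn f (Ioo 0 1)) :
    ∫ z in Ioo (0 : ℝ) 1, f z = (∫ z in Ioo 0 α, f z) + ∫ z in Ioo α 1, f z := by
  rw [← Ioc_union_Ioo_one hα, setIntegral_union _ measurableSet_Ioo, integral_Ioc_eq_integral_Ioo]
  · exact hf.mono_set (Ioc_subset_Ioo_right hα.2)
  · exact hf.mono_set (Ioo_one_subset hα)
  · exact disjoint_left.2 fun z hz hz' => hz.2.not_gt hz'.1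

lemma IsKernel.integrableOn_slopeGap (hq : IsKernel q) (hα : α ∈ Ioo (0 : ℝ) 1) :
    IntegrableOn (slopeGap q α b c) (Ioo 0 1) := by
  rw [← Ioc_union_Ioo_one hα]
  exact (hq.integrableOn_slopeGap_pieces hα).1.union (hq.integrableOn_slopeGap_pieces hα).2

lemma IsKernel.integral_slopeGap (hq : IsKernel q) (hα : α ∈ Ioo (0 : ℝ) 1)
    (hbc : lowerGap q α b = upperGap q α c) : ∫ z in Ioo (0 : ℝ) 1, slopeGap q α b c z = 0 := by
  rw [setIntegral_Ioo_split hα (hq.integrableOn_slopeGap hα),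
    setIntegral_congr_fun (g := fun z => -max (b - q z) 0) measurableSet_Ioo
      (fun z hz => by simp [slopeGap, hz.2.le]),
    setIntegral_congr_fun (s := Ioo α 1) (g := fun z => max (q z - c) 0) measurableSet_Ioo
      (fun z hz => by simp [slopeGap, hz.1]), integral_neg]
  change -lowerGap q α b + upperGap q α c = 0
  rw [hbc, neg_add_cancel]

lemma IsKernel.integrableOn_mul_slopeGap (hq : IsKernel q) (hα : α ∈ Ioo (0 : ℝ) 1) (hc0 : 0 < c)
    (hc : c ≤ q α) {H : ℝ → ℝ} (hH : MonotoneOn H (Ioo 0 1))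
    (hH0 : ∀ z ∈ Ioo (0 : ℝ) 1, 0 ≤ H z) :
    IntegrableOn (fun z => H z * slopeGap q α b c z) (Ioo 0 1) := by
  obtain ⟨w, hw, hqw⟩ := hq.exists_eq hc0
  refine Integrable.mono' ((hq.integrableOn_slopeGap (b := b) (c := c) hα).norm.const_mul (H w))
    ?_ ?_
  · exact (aemeasurable_restrict_of_monotoneOn measurableSet_Ioo hH).aestronglyMeasurable.mul
      (hq.integrableOn_slopeGap hα).aestronglyMeasurable
  · filter_upwards [ae_restrict_mem measurableSet_Ioo] with z hz
    rw [norm_mul, Real.norm_eq_abs (H z), abs_of_nonneg (hH0 z hz)]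
    rcases le_or_gt z w with h | h
    · exact mul_le_mul_of_nonneg_right (hH hz hw h) (norm_nonneg _)
    · have h1 : q z < c := hqw ▸ hq.strictAntiOn hw hz h
      have h2 : ¬ z ≤ α := fun h2 => by
        have := hq.strictAntiOn.antitoneOn hz hα h2
        linarith
      have h3 : slopeGap q α b c z = 0 := by
        rw [slopeGap, if_neg h2, max_eq_right (by linarith)]
      simp [h3]

/-- An increasing function puts more weight on `(α, 1)`, where `slopeGap` is nonnegative. -/
lemma IsKernel.integral_mul_slopeGap_nonneg (hq : IsKernel q) (hα : α ∈ Ioo (0 : ℝ) 1)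
    (hc0 : 0 < c) (hc : c ≤ q α) (hbc : lowerGap q α b = upperGap q α c) {H : ℝ → ℝ}
    (hH : MonotoneOn H (Ioo 0 1)) (hH0 : ∀ z ∈ Ioo (0 : ℝ) 1, 0 ≤ H z) :
    0 ≤ ∫ z in Ioo (0 : ℝ) 1, H z * slopeGap q α b c z := by
  have h : ∫ z in Ioo (0 : ℝ) 1, H α * slopeGap q α b c z
      ≤ ∫ z in Ioo (0 : ℝ) 1, H z * slopeGap q α b c z := by
    refine setIntegral_mono_on ((hq.integrableOn_slopeGap hα).const_mul _)
      (hq.integrableOn_mul_slopeGap hα hc0 hc hH hH0) measurableSet_Ioo fun z hz => ?_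
    unfold slopeGap
    split_ifs with h
    · exact mul_le_mul_of_nonpos_right (hH hz hα h) (neg_nonpos.2 (le_max_right _ _))
    · exact mul_le_mul_of_nonneg_right (hH hα hz (not_le.1 h).le) (le_max_right _ _)
  rwa [integral_const_mul, hq.integral_slopeGap hα hbc, mul_zero] at h

/-- A function of the slope of the envelope is constant on the interval where `φ_λ` differs from
its envelope. -/
lemma IsKernel.integral_comp_mul_slopeGap (hq : IsKernel q) (hα : α ∈ Ioo (0 : ℝ) 1)
    (hc : c ≤ q α) (hb : q α ≤ b) (hbc : lowerGap q α b = upperGap q α c) (g : ℝ → ℝ) :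
    ∫ z in Ioo (0 : ℝ) 1, g (envelopeSlope (b - c) c (q z)) * slopeGap q α b c z = 0 := by
  rw [setIntegral_congr_fun (g := fun z => g c * slopeGap q α b c z) measurableSet_Ioo,
    integral_const_mul, hq.integral_slopeGap hα hbc, mul_zero]
  intro z hz
  by_cases h : slopeGap q α b c z = 0
  · simp [h]
  · suffices c ≤ q z ∧ q z ≤ b by
      simp only
      rw [envelopeSlope_of_mem this.1 (by linarith)]
    unfold slopeGap at h
    split_ifs at h with hzα
    · have h1 := hq.strictAntiOn.antitoneOn hz hα hzα
      refine ⟨hc.trans h1, ?_⟩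
      by_contra! h2
      exact h (by rw [max_eq_right (by linarith), neg_zero])
    · have h1 := hq.strictAntiOn hα hz (not_le.1 hzα)
      refine ⟨?_, by linarith⟩
      by_contra! h2
      exact h (max_eq_right (by linarith))

end Gap

/-! ### The budget along the tangency curve -/

section Budget

variable {q W b ν : ℝ → ℝ} {α t : ℝ}

/-- The slope of the envelope at the point `c` of the tangency curve `b`. -/
noncomputable def curveSlope (q b : ℝ → ℝ) (c z : ℝ) : ℝ := envelopeSlope (b c - c) c (q z)

lemma IsTangency.sub_nonneg (hb : IsTangency q α b) {c : ℝ} (hc : c ∈ Icc 0 (q α)) :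
    0 ≤ b c - c := by
  linarith [hb.le c hc, hc.2]

lemma IsTangency.isPrice (hb : IsTangency q α b) (hq : IsKernel q) {c : ℝ}
    (hc : c ∈ Ioc 0 (q α)) : IsPrice q (curveSlope q b c) :=
  hq.isPrice_envelopeSlope (hb.sub_nonneg (Ioc_subset_Icc_self hc)) hc.1

lemma IsTangency.curveSlope_self (hb : IsTangency q α b) (hq : IsKernel q)
    (hα : α ∈ Ioo (0 : ℝ) 1) : curveSlope q b (q α) = q := by
  ext z
  rw [curveSlope, hb.apply_self hq hα, sub_self, envelopeSlope, sub_zero,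
    max_eq_left (min_le_right _ _)]

lemma IsTangency.continuousOn_curveSlope (hb : IsTangency q α b) (hq : IsKernel q)
    (hα : α ∈ Ioo (0 : ℝ) 1) (z : ℝ) :
    ContinuousOn (fun c => curveSlope q b c z) (Icc 0 (q α)) := by
  have h := hb.continuousOn hq hα
  unfold curveSlope envelopeSlope
  exact ContinuousOn.sup (continuousOn_const.sub (h.sub continuousOn_id))
    (continuousOn_id.inf continuousOn_const)

/-- `ν c` is the multiplier of the budget constraint for which the tail constraint binds at the
point `c` of the tangency curve. -/
structure IsMultiplier (W q : ℝ → ℝ) (α : ℝ) (b : ℝ → ℝ) (t : ℝ) (ν : ℝ → ℝ) : Prop where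
  pos : ∀ c ∈ Ioc 0 (q α), 0 < ν c
  eq : ∀ c ∈ Ioc 0 (q α), tailDemand W α (curveSlope q b c) (ν c) = t

lemma IsTangency.exists_isMultiplier (hb : IsTangency q α b) (hq : IsKernel q) (hW : IsDemand W)
    (hα : α ∈ Ioo (0 : ℝ) 1) (ht : 0 < t) : ∃ ν, IsMultiplier W q α b t ν := by
  have key : ∀ c, ∃ ν, c ∈ Ioc 0 (q α) → 0 < ν ∧ tailDemand W α (curveSlope q b c) ν = t := by
    intro c
    by_cases hc : c ∈ Ioc 0 (q α)
    · obtain ⟨ν, hν⟩ := (hb.isPrice hq hc).exists_tailDemand_eq hq hW hα ht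
      exact ⟨ν, fun _ => hν⟩
    · exact ⟨0, fun h => absurd h hc⟩
  choose ν hν using key
  exact ⟨ν, fun c hc => (hν c hc).1, fun c hc => (hν c hc).2⟩

lemma IsKernel.right_mem (hq : IsKernel q) (hα : α ∈ Ioo (0 : ℝ) 1) : q α ∈ Ioc 0 (q α) :=
  ⟨hq.pos hα, le_rfl⟩

lemma IsMultiplier.le (hν : IsMultiplier W q α b t ν) (hb : IsTangency q α b) (hq : IsKernel q)
    (hW : IsDemand W) (hα : α ∈ Ioo (0 : ℝ) 1) (ht : 0 < t) {c : ℝ} (hc : c ∈ Ioc 0 (q α)) :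
    ν (q α) ≤ ν c := by
  by_contra! h
  have h0 := hν.pos c hc
  have h1 := hν.eq _ (hq.right_mem hα)
  rw [hb.curveSlope_self hq hα] at h1
  have h2 := hq.isPrice.tailDemand_anti hW hα h0 h.le
  have h3 := hq.isPrice.tailDemand_lt hW hα h0 h (by linarith)
  have h4 := (hb.isPrice hq hc).tailDemand_le_of_price_le hq.isPrice hW hα
    (hb.isPrice hq hc).le h0
  rw [hν.eq c hc] at h4
  linarith

lemma IsTangency.continuousOn_tailDemand (hb : IsTangency q α b) (hq : IsKernel q)
    (hW : IsDemand W) (hα : α ∈ Ioo (0 : ℝ) 1) {x : ℝ} (hx : 0 < x) :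
    ContinuousOn (fun c => tailDemand W α (curveSlope q b c) x) (Ioc 0 (q α)) := by
  intro c₀ hc₀
  have hev : ∀ᶠ c in 𝓝[Ioc 0 (q α)] c₀, c₀ / 2 < c :=
    mem_nhdsWithin_of_mem_nhds (lt_mem_nhds (by linarith [hc₀.1]))
  refine hW.tendsto_integral (ε := x * (c₀ / 2)) (mul_pos hx (half_pos hc₀.1)) ?_ ?_ ?_ ?_
  · filter_upwards [self_mem_nhdsWithin] with c hc y hy z hz hyz
    exact mul_le_mul_of_nonneg_left ((hb.isPrice hq hc).antitoneOn (Ioo_zero_subset hα hy)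
      (Ioo_zero_subset hα hz) hyz) hx.le
  · filter_upwards [self_mem_nhdsWithin, hev] with c hc hc2 z hz
    have h1 := hq.strictAntiOn.antitoneOn (Ioo_zero_subset hα hz) hα hz.2.le
    exact mul_le_mul_of_nonneg_left (hc2.le.trans (le_envelopeSlope (hc.2.trans h1))) hx.le
  · exact fun z hz => mul_pos hx ((hb.isPrice hq hc₀).pos z (Ioo_zero_subset hα hz))
  · exact fun z _ => ((hb.continuousOn_curveSlope hq hα z c₀
      (Ioc_subset_Icc_self hc₀)).mono Ioc_subset_Icc_self).tendsto.const_mul x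

lemma IsMultiplier.continuousOn (hν : IsMultiplier W q α b t ν) (hb : IsTangency q α b)
    (hq : IsKernel q) (hW : IsDemand W) (hα : α ∈ Ioo (0 : ℝ) 1) (ht : 0 < t) :
    ContinuousOn ν (Ioc 0 (q α)) := by
  refine continuousOn_root (J := Ioi 0)
    (f := fun c x => t - tailDemand W α (curveSlope q b c) x) ordConnected_Ioi hν.pos ?_ ?_ ?_ ?_
  · exact fun x hx => continuousOn_const.sub (hb.continuousOn_tailDemand hq hW hα hx)
  · intro c hc x hx hlt
    have h0 := (hb.isPrice hq hc).tailDemand_anti hW hα hx hlt.le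
    have h1 := (hb.isPrice hq hc).tailDemand_lt hW hα hx hlt
    rw [hν.eq c hc] at h0 h1
    have := h1 (by linarith)
    linarith
  · intro c hc x hx hlt
    have h1 := (hb.isPrice hq hc).tailDemand_lt hW hα (hν.pos c hc) hlt
    rw [hν.eq c hc] at h1
    linarith [h1 ht]
  · intro c hc
    simp only [hν.eq c hc, sub_self]

/-- The demand at the point `c` of the tangency curve when the tail constraint binds. -/
noncomputable def curveDemand (W q b ν : ℝ → ℝ) (c z : ℝ) : ℝ := W (ν c * curveSlope q b c z)

lemma curveDemand_nonneg (hW : IsDemand W) (c z : ℝ) : 0 ≤ curveDemand W q b ν c z :=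
  hW.nonneg _

lemma IsMultiplier.monotoneOn (hν : IsMultiplier W q α b t ν) (hb : IsTangency q α b)
    (hq : IsKernel q) (hW : IsDemand W) {c : ℝ} (hc : c ∈ Ioc 0 (q α)) :
    MonotoneOn (curveDemand W q b ν c) (Ioo 0 1) :=
  (hb.isPrice hq hc).monotoneOn_demand hW (hν.pos c hc)

lemma IsMultiplier.aestronglyMeasurable (hν : IsMultiplier W q α b t ν) (hb : IsTangency q α b)
    (hq : IsKernel q) (hW : IsDemand W) {c : ℝ} (hc : c ∈ Ioc 0 (q α)) :
    AEStronglyMeasurable (curveDemand W q b ν c) (volume.restrict (Ioo 0 1)) :=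
  (aemeasurable_restrict_of_monotoneOn measurableSet_Ioo
    (hν.monotoneOn hb hq hW hc)).aestronglyMeasurable

/-- Up to `z₂` the demand is at most its value at the price `ν c`, and after `z₂` it is the
demand of the problem without tail constraint. -/
lemma IsMultiplier.curveDemand_le (hν : IsMultiplier W q α b t ν) (hb : IsTangency q α b)
    (hq : IsKernel q) (hW : IsDemand W) (hα : α ∈ Ioo (0 : ℝ) 1) (ht : 0 < t) {c : ℝ}
    (hc : c ∈ Ioc 0 (q α)) {z : ℝ} (hz : z ∈ Ioo (0 : ℝ) 1) :
    curveDemand W q b ν c z ≤ W (ν c * c) + W (ν (q α) * q z) := by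
  have h0 := hν.pos c hc
  have h00 := hν.pos _ (hq.right_mem hα)
  have hp := (hb.isPrice hq hc).pos z hz
  rcases le_total c (q z) with h | h
  · refine le_add_of_le_of_nonneg ?_ (hW.nonneg _)
    exact hW.antitoneOn (mul_pos h0 hc.1) (mul_pos h0 hp)
      (mul_le_mul_of_nonneg_left (le_envelopeSlope h) h0.le)
  · refine le_add_of_nonneg_of_le (hW.nonneg _) ?_
    have h1 : curveSlope q b c z = q z :=
      envelopeSlope_of_le (hb.sub_nonneg (Ioc_subset_Icc_self hc)) h
    rw [curveDemand, h1]
    exact hW.antitoneOn (mul_pos h00 (hq.pos hz)) (mul_pos h0 (hq.pos hz))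
      (mul_le_mul_of_nonneg_right (hν.le hb hq hW hα ht hc) (hq.pos hz).le)

/-- The cost `∫₀¹ G(z) F⁻¹(1 - z) dz` of the demand at the point `c` of the tangency curve. -/
noncomputable def curveBudget (W q b ν : ℝ → ℝ) (c : ℝ) : ℝ :=
  ∫ z in Ioo (0 : ℝ) 1, curveDemand W q b ν c z * q z

lemma IsKernel.integrableOn_bound (hq : IsKernel q)
    (hC : IntegrableOn (fun z => W (ν (q α) * q z) * q z) (Ioo 0 1)) (M : ℝ) :
    IntegrableOn (fun z => (M + W (ν (q α) * q z)) * q z) (Ioo 0 1) := by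
  simp only [add_mul]
  exact (hq.integrableOn.const_mul M).add hC

lemma IsMultiplier.integrableOn (hν : IsMultiplier W q α b t ν) (hb : IsTangency q α b)
    (hq : IsKernel q) (hW : IsDemand W) (hα : α ∈ Ioo (0 : ℝ) 1) (ht : 0 < t)
    (hC : IntegrableOn (fun z => W (ν (q α) * q z) * q z) (Ioo 0 1)) {c : ℝ}
    (hc : c ∈ Ioc 0 (q α)) :
    IntegrableOn (fun z => curveDemand W q b ν c z * q z) (Ioo 0 1) := by
  refine (hq.integrableOn_bound hC (W (ν c * c))).mono'
    ((hν.aestronglyMeasurable hb hq hW hc).mul hq.integrableOn.aestronglyMeasurable) ?_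
  filter_upwards [ae_restrict_mem measurableSet_Ioo] with z hz
  rw [Real.norm_eq_abs, abs_of_nonneg (mul_nonneg (curveDemand_nonneg hW _ _) (hq.pos hz).le)]
  exact mul_le_mul_of_nonneg_right (hν.curveDemand_le hb hq hW hα ht hc hz) (hq.pos hz).le

lemma IsMultiplier.continuousOn_curveBudget (hν : IsMultiplier W q α b t ν)
    (hb : IsTangency q α b) (hq : IsKernel q) (hW : IsDemand W) (hα : α ∈ Ioo (0 : ℝ) 1)
    (ht : 0 < t) (hC : IntegrableOn (fun z => W (ν (q α) * q z) * q z) (Ioo 0 1)) :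
    ContinuousOn (curveBudget W q b ν) (Ioc 0 (q α)) := by
  intro c₀ hc₀
  have h00 := hν.pos _ (hq.right_mem hα)
  have hev : ∀ᶠ c in 𝓝[Ioc 0 (q α)] c₀, c₀ / 2 < c :=
    mem_nhdsWithin_of_mem_nhds (lt_mem_nhds (by linarith [hc₀.1]))
  refine continuousWithinAt_of_dominated
    (bound := fun z => (W (ν (q α) * (c₀ / 2)) + W (ν (q α) * q z)) * q z) ?_ ?_
    (hq.integrableOn_bound hC _) ?_
  · filter_upwards [self_mem_nhdsWithin] with c hc
    exact (hν.aestronglyMeasurable hb hq hW hc).mul hq.integrableOn.aestronglyMeasurable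
  · filter_upwards [self_mem_nhdsWithin, hev] with c hc hc2
    filter_upwards [ae_restrict_mem measurableSet_Ioo] with z hz
    rw [Real.norm_eq_abs, abs_of_nonneg (mul_nonneg (curveDemand_nonneg hW _ _) (hq.pos hz).le)]
    refine mul_le_mul_of_nonneg_right ((hν.curveDemand_le hb hq hW hα ht hc hz).trans ?_)
      (hq.pos hz).le
    refine add_le_add_left ?_ _
    exact hW.antitoneOn (mul_pos h00 (half_pos hc₀.1)) (mul_pos (hν.pos c hc) hc.1)
      (mul_le_mul (hν.le hb hq hW hα ht hc) hc2.le (half_pos hc₀.1).le (hν.pos c hc).le)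
  · filter_upwards [ae_restrict_mem measurableSet_Ioo] with z hz
    have hpos := mul_pos (hν.pos _ hc₀) ((hb.isPrice hq hc₀).pos z hz)
    have h1 : ContinuousWithinAt (fun c => ν c * curveSlope q b c z) (Ioc 0 (q α)) c₀ :=
      (hν.continuousOn hb hq hW hα ht c₀ hc₀).mul
        ((hb.continuousOn_curveSlope hq hα z c₀ (Ioc_subset_Icc_self hc₀)).mono
          Ioc_subset_Icc_self)
    have h2 : ContinuousWithinAt (fun c => curveDemand W q b ν c z) (Ioc 0 (q α)) c₀ :=
      (hW.continuousOn.continuousAt (Ioi_mem_nhds hpos)).comp_continuousWithinAt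
        (f := fun c => ν c * curveSlope q b c z) h1
    exact h2.mul continuousWithinAt_const

lemma IsTangency.curveBudget_self (hb : IsTangency q α b) (hq : IsKernel q)
    (hα : α ∈ Ioo (0 : ℝ) 1) :
    curveBudget W q b ν (q α) = ∫ z in Ioo (0 : ℝ) 1, W (ν (q α) * q z) * q z := by
  simp only [curveBudget, curveDemand, hb.curveSlope_self hq hα]

lemma IsMultiplier.integrableOn_mul_curveSlope (hν : IsMultiplier W q α b t ν)
    (hb : IsTangency q α b) (hq : IsKernel q) (hW : IsDemand W) (hα : α ∈ Ioo (0 : ℝ) 1)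
    (ht : 0 < t) (hC : IntegrableOn (fun z => W (ν (q α) * q z) * q z) (Ioo 0 1)) {c : ℝ}
    (hc : c ∈ Ioc 0 (q α)) :
    IntegrableOn (fun z => curveDemand W q b ν c z * curveSlope q b c z) (Ioo 0 1) := by
  refine (hν.integrableOn hb hq hW hα ht hC hc).mono'
    ((hν.aestronglyMeasurable hb hq hW hc).mul (aemeasurable_restrict_of_antitoneOn
      measurableSet_Ioo (hb.isPrice hq hc).antitoneOn).aestronglyMeasurable) ?_
  filter_upwards [ae_restrict_mem measurableSet_Ioo] with z hz
  have hp := (hb.isPrice hq hc).pos z hz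
  rw [Real.norm_eq_abs, abs_of_nonneg (mul_nonneg (curveDemand_nonneg hW _ _) hp.le)]
  exact mul_le_mul_of_nonneg_left ((hb.isPrice hq hc).le z hz) (hW.nonneg _)

lemma integral_mul_indicator_tail (hα : α ∈ Ioo (0 : ℝ) 1) (H : ℝ → ℝ) (a : ℝ) :
    ∫ z in Ioo (0 : ℝ) 1, H z * (if z ≤ α then a else 0) = a * ∫ z in Ioo 0 α, H z := by
  have h : (fun z => H z * (if z ≤ α then a else 0)) = (Iic α).indicator fun z => a * H z := by
    ext z
    by_cases hz : z ≤ α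
    · simp [hz, mul_comm]
    · simp [hz]
  rw [h, setIntegral_indicator measurableSet_Iic, ← integral_const_mul,
    show Ioo (0 : ℝ) 1 ∩ Iic α = Ioc 0 α from ?_, integral_Ioc_eq_integral_Ioo]
  ext z
  simp only [mem_inter_iff, mem_Ioo, mem_Iic, mem_Ioc]
  exact ⟨fun h => ⟨h.1.1, h.2⟩, fun h => ⟨⟨h.1, h.2.trans_lt hα.2⟩, h.2⟩⟩

lemma integrableOn_mul_indicator_tail (hα : α ∈ Ioo (0 : ℝ) 1) {H : ℝ → ℝ}
    (hH : MonotoneOn H (Ioo 0 1)) (hH0 : ∀ z ∈ Ioo (0 : ℝ) 1, 0 ≤ H z) (a : ℝ) :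
    IntegrableOn (fun z => H z * (if z ≤ α then a else 0)) (Ioo 0 1) := by
  have h : (fun z => H z * (if z ≤ α then a else 0)) = (Iic α).indicator fun z => a * H z := by
    ext z
    by_cases hz : z ≤ α
    · simp [hz, mul_comm]
    · simp [hz]
  rw [h, integrableOn_indicator_iff measurableSet_Iic,
    show Iic α ∩ Ioo (0 : ℝ) 1 = Ioc 0 α from ?_, integrableOn_Ioc_iff_integrableOn_Ioo]
  · exact (integrableOn_of_monotoneOn hα hH hH0).const_mul a
  ext z
  simp only [mem_inter_iff, mem_Ioo, mem_Iic, mem_Ioc]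
  exact ⟨fun h => ⟨h.2.1, h.1⟩, fun h => ⟨h.2, h.1, h.2.trans_lt hα.2⟩⟩

/-- The cost splits into the cost at the prices given by the envelope and the value of the
tail constraint. -/
lemma IsMultiplier.curveBudget_eq (hν : IsMultiplier W q α b t ν)
    (hb : IsTangency q α b) (hq : IsKernel q) (hW : IsDemand W) (hα : α ∈ Ioo (0 : ℝ) 1)
    (ht : 0 < t) (hC : IntegrableOn (fun z => W (ν (q α) * q z) * q z) (Ioo 0 1)) {c : ℝ}
    (hc : c ∈ Ioc 0 (q α)) :
    curveBudget W q b ν c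
      = (∫ z in Ioo (0 : ℝ) 1, curveDemand W q b ν c z * curveSlope q b c z)
        + (b c - c) * t := by
  have hc' := Ioc_subset_Icc_self hc
  have hmono := hν.monotoneOn hb hq hW hc
  have h1 : ∀ z ∈ Ioo (0 : ℝ) 1, curveDemand W q b ν c z * q z
      = curveDemand W q b ν c z * curveSlope q b c z
        + curveDemand W q b ν c z * slopeGap q α (b c) c z
        + curveDemand W q b ν c z * (if z ≤ α then b c - c else 0) := by
    intro z hz
    rw [hq.slopeGap_eq hα hc.2 (hb.le c hc') hz, curveSlope]
    ring
  have hi1 := hν.integrableOn_mul_curveSlope hb hq hW hα ht hC hc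
  have hi2 := hq.integrableOn_mul_slopeGap hα hc.1 hc.2 (b := b c) hmono
    fun _ _ => hW.nonneg _
  have hi3 := integrableOn_mul_indicator_tail hα hmono (fun _ _ => hW.nonneg _) (b c - c)
  have hi12 : IntegrableOn (fun z => curveDemand W q b ν c z * curveSlope q b c z
      + curveDemand W q b ν c z * slopeGap q α (b c) c z) (Ioo 0 1) := hi1.add hi2
  have h2 : ∫ z in Ioo (0 : ℝ) 1, curveDemand W q b ν c z * slopeGap q α (b c) c z = 0 :=
    hq.integral_comp_mul_slopeGap hα hc.2 (hb.le c hc') (hb.eq c hc') fun x => W (ν c * x)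
  rw [curveBudget, setIntegral_congr_fun measurableSet_Ioo h1, integral_add hi12 hi3,
    integral_add hi1 hi2, h2, add_zero, integral_mul_indicator_tail hα]
  congr 2
  exact hν.eq c hc

/-- As `c ↓ 0` the demand on `(z₁, z₂]` stays bounded, because it is bounded by the tail average
divided by the length of `(z₁, α)`. -/
lemma IsMultiplier.exists_bound (hν : IsMultiplier W q α b t ν) (hb : IsTangency q α b)
    (hq : IsKernel q) (hW : IsDemand W) (hα : α ∈ Ioo (0 : ℝ) 1) :
    ∃ M, ∀ c ∈ Ioc 0 (q α / 2), W (ν c * c) ≤ M := by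
  have hqα := hq.pos hα
  have hlt : q α < b (q α / 2) := by
    have := hb.lt_of_lt hq hα (half_pos hqα).le (half_lt_self hqα) le_rfl
    rwa [hb.apply_self hq hα] at this
  obtain ⟨w, hw, hqw⟩ := hq.exists_eq (hqα.trans hlt)
  have hwα : w < α := (hq.strictAntiOn.lt_iff_gt hα hw).1 (by rwa [hqw])
  refine ⟨t / (α - w), fun c hc => ?_⟩
  have hc' : c ∈ Ioc 0 (q α) := ⟨hc.1, by linarith [hc.2]⟩
  have hint : IntegrableOn (curveDemand W q b ν c) (Ioo 0 α) :=
    integrableOn_of_monotoneOn hα (hν.monotoneOn hb hq hW hc') fun _ _ => hW.nonneg _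
  have h1 : ∫ z in Ioo w α, W (ν c * c) ≤ ∫ z in Ioo w α, curveDemand W q b ν c z := by
    refine setIntegral_mono_on (integrable_const _) (hint.mono_set (Ioo_subset_Ioo_left hw.1.le))
      measurableSet_Ioo fun z hz => ?_
    have hz1 : z ∈ Ioo (0 : ℝ) 1 := ⟨hw.1.trans hz.1, hz.2.trans hα.2⟩
    have h2 : q z < q w := hq.strictAntiOn hw hz1 hz.1
    have h3 : q α < q z := hq.strictAntiOn hz1 hα hz.2
    have h4 : b (q α / 2) ≤ b c := hb.antitoneOn hq hα (Ioc_subset_Icc_self hc')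
      ⟨(half_pos hqα).le, by linarith⟩ hc.2
    rw [curveDemand, curveSlope, envelopeSlope_of_mem (by linarith [hc'.2]) (by linarith)]
  have h2 : ∫ z in Ioo w α, curveDemand W q b ν c z ≤ ∫ z in Ioo 0 α, curveDemand W q b ν c z :=
    setIntegral_mono_set hint (Eventually.of_forall fun _ => hW.nonneg _)
      (Ioo_subset_Ioo_left hw.1.le).eventuallyLE
  have h3 : ∫ z in Ioo 0 α, curveDemand W q b ν c z = t := hν.eq c hc'
  rw [integral_const, measureReal_restrict_apply_univ,
    Real.volume_real_Ioo_of_le hwα.le, smul_eq_mul] at h1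
  rw [le_div_iff₀ (by linarith)]
  linarith

/-- As `c ↓ 0`, the cost at the prices given by the envelope vanishes. -/
lemma IsMultiplier.tendsto_integral_zero (hν : IsMultiplier W q α b t ν)
    (hb : IsTangency q α b) (hq : IsKernel q) (hW : IsDemand W) (hα : α ∈ Ioo (0 : ℝ) 1)
    (ht : 0 < t) (hC : IntegrableOn (fun z => W (ν (q α) * q z) * q z) (Ioo 0 1)) :
    Tendsto (fun c => ∫ z in Ioo (0 : ℝ) 1, curveDemand W q b ν c z * curveSlope q b c z)
      (𝓝[>] 0) (𝓝 0) := by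
  have hqα := hq.pos hα
  obtain ⟨M, hM⟩ := hν.exists_bound hb hq hW hα
  have hsub : ∀ {c}, c ∈ Ioc 0 (q α / 2) → c ∈ Ioc 0 (q α) :=
    fun hc => ⟨hc.1, by linarith [hc.2]⟩
  have hev : ∀ᶠ c in 𝓝[>] (0 : ℝ), c ∈ Ioc 0 (q α / 2) := Ioc_mem_nhdsGT (half_pos hqα)
  have hb0 : Tendsto (fun c => b c - c) (𝓝[>] 0) (𝓝 (b 0)) := by
    have h1 : Tendsto b (𝓝[>] 0) (𝓝 (b 0)) := by
      have := (hb.continuousOn hq hα 0 ⟨le_rfl, hqα.le⟩).tendsto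
      rw [nhdsWithin_Icc_eq_nhdsGE hqα] at this
      exact this.mono_left (nhdsWithin_mono _ Ioi_subset_Ici_self)
    simpa using h1.sub (tendsto_id.mono_left nhdsWithin_le_nhds : Tendsto id (𝓝[>] (0 : ℝ)) (𝓝 0))
  have hνtop : Tendsto ν (𝓝[>] 0) atTop := by
    obtain ⟨ε, hε, hWε⟩ := hW.exists_gt M
    have h1 : Tendsto (fun c : ℝ => ε * c⁻¹) (𝓝[>] 0) atTop :=
      tendsto_inv_nhdsGT_zero.const_mul_atTop hε
    refine tendsto_atTop_mono' _ ?_ h1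
    filter_upwards [hev] with c hc
    rw [← div_eq_mul_inv, div_le_iff₀ hc.1]
    by_contra! hlt
    have := hW.antitoneOn (mul_pos (hν.pos c (hsub hc)) hc.1) hε hlt.le
    linarith [hM c hc]
  rw [show 𝓝 (0 : ℝ) = 𝓝 (∫ _ in Ioo (0 : ℝ) 1, (0 : ℝ)) by rw [integral_zero]]
  refine tendsto_integral_filter_of_dominated_convergence
    (fun z => (M + W (ν (q α) * q z)) * q z) ?_ ?_ (hq.integrableOn_bound hC M) ?_
  · filter_upwards [hev] with c hc
    exact (hν.integrableOn_mul_curveSlope hb hq hW hα ht hC (hsub hc)).aestronglyMeasurable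
  · filter_upwards [hev] with c hc
    filter_upwards [ae_restrict_mem measurableSet_Ioo] with z hz
    have hp := hb.isPrice hq (hsub hc)
    rw [Real.norm_eq_abs, abs_of_nonneg (mul_nonneg (curveDemand_nonneg hW _ _) (hp.pos z hz).le)]
    have h1 := (hν.curveDemand_le hb hq hW hα ht (hsub hc) hz).trans
      (add_le_add_left (hM c hc) _)
    exact mul_le_mul h1 (hp.le z hz) (hp.pos z hz).le ((hW.nonneg _).trans h1)
  · filter_upwards [ae_restrict_mem measurableSet_Ioo] with z hz
    have hqz := hq.pos hz
    have hev2 : ∀ᶠ c in 𝓝[>] (0 : ℝ), c ∈ Ioc 0 (q α / 2) ∧ c ≤ q z :=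
      hev.and (mem_of_superset (Ioc_mem_nhdsGT hqz) fun _ h => h.2)
    have hc0 : Tendsto (fun c : ℝ => c) (𝓝[>] 0) (𝓝 0) :=
      tendsto_id.mono_left nhdsWithin_le_nhds
    have hslope : Tendsto (fun c => curveSlope q b c z) (𝓝[>] 0) (𝓝 (max (q z - b 0) 0)) := by
      refine ((tendsto_const_nhds.sub hb0).max hc0).congr' ?_
      filter_upwards [hev2] with c hc
      rw [curveSlope, envelopeSlope_of_ge hc.2]
    rcases le_or_gt (q z) (b 0) with h | h
    · rw [max_eq_right (by linarith)] at hslope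
      refine squeeze_zero' ?_ ?_ (by simpa using hslope.const_mul M)
      · filter_upwards [hev2] with c hc
        exact mul_nonneg (hW.nonneg _) ((hb.isPrice hq (hsub hc.1)).pos z hz).le
      · filter_upwards [hev2] with c hc
        have hp := (hb.isPrice hq (hsub hc.1)).pos z hz
        have h0 := hν.pos c (hsub hc.1)
        refine mul_le_mul_of_nonneg_right (le_trans ?_ (hM c hc.1)) hp.le
        exact hW.antitoneOn (mul_pos h0 hc.1.1) (mul_pos h0 hp)
          (mul_le_mul_of_nonneg_left (le_envelopeSlope hc.2) h0.le)
    · rw [max_eq_left (by linarith)] at hslope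
      have h1 := (hW.tendsto_top.comp (hνtop.atTop_mul_pos (sub_pos.2 h) hslope)).mul hslope
      simpa [curveDemand, Function.comp_def] using h1

/-- The cost sweeps out the whole range between the two thresholds. -/
lemma IsMultiplier.exists_curveBudget_eq (hν : IsMultiplier W q α b t ν)
    (hb : IsTangency q α b) (hq : IsKernel q) (hW : IsDemand W) (hα : α ∈ Ioo (0 : ℝ) 1)
    (ht : 0 < t) (hC : IntegrableOn (fun z => W (ν (q α) * q z) * q z) (Ioo 0 1)) {x : ℝ}
    (hlow : b 0 * t < x) (hup : x < ∫ z in Ioo (0 : ℝ) 1, W (ν (q α) * q z) * q z) :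
    ∃ c ∈ Ioo 0 (q α), curveBudget W q b ν c = x := by
  have hqα := hq.pos hα
  have hev : ∀ᶠ c in 𝓝[>] (0 : ℝ), c ∈ Ioc 0 (q α) := Ioc_mem_nhdsGT hqα
  have h0 := hν.tendsto_integral_zero hb hq hW hα ht hC
  obtain ⟨c, hc, hcl⟩ := (hev.and (h0.eventually_lt_const (sub_pos.2 hlow))).exists
  have hb' : (b c - c) * t ≤ b 0 * t := by
    have := hb.antitoneOn hq hα ⟨le_rfl, hqα.le⟩ (Ioc_subset_Icc_self hc) hc.1.le
    exact mul_le_mul_of_nonneg_right (by linarith [hc.1]) ht.le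
  have hlt : curveBudget W q b ν c ≤ x := by
    rw [hν.curveBudget_eq hb hq hW hα ht hC hc]
    linarith
  rw [← hb.curveBudget_self (W := W) (ν := ν) hq hα] at hup
  obtain ⟨d, hd, hdx⟩ := intermediate_value_Icc hc.2
    ((hν.continuousOn_curveBudget hb hq hW hα ht hC).mono fun y hy => ⟨hc.1.trans_le hy.1, hy.2⟩)
    ⟨hlt, hup.le⟩
  refine ⟨d, ⟨hc.1.trans_le hd.1, lt_of_le_of_ne hd.2 fun h => ?_⟩, hdx⟩
  rw [h] at hdx
  exact hup.ne' hdx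

end Budget

/-! ### The extended integral -/

lemma extIntegral_of_integrableOn {f : ℝ → ℝ} (hf : IntegrableOn f (Ioo 0 1)) :
    extIntegral f = ((∫ z in Ioo (0 : ℝ) 1, f z : ℝ) : EReal) := by
  have h1 : ∫⁻ z in Ioo (0 : ℝ) 1, ENNReal.ofReal (f z) ≠ ⊤ := hf.lintegral_lt_top.ne
  have h2 : ∫⁻ z in Ioo (0 : ℝ) 1, ENNReal.ofReal (-f z) ≠ ⊤ := hf.neg.lintegral_lt_top.ne
  rw [integral_eq_lintegral_pos_part_sub_lintegral_neg_part hf, EReal.coe_sub,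
    EReal.coe_ennreal_toReal, EReal.coe_ennreal_toReal]
  · rfl
  · exact h2
  · exact h1

lemma extIntegral_eq_bot {f g : ℝ → ℝ} (hf : AEMeasurable f (volume.restrict (Ioo 0 1)))
    (hg : IntegrableOn g (Ioo 0 1)) (hle : ∀ z ∈ Ioo (0 : ℝ) 1, f z ≤ g z)
    (hnot : ¬ IntegrableOn f (Ioo 0 1)) : extIntegral f = ⊥ := by
  have h1 : ∫⁻ z in Ioo (0 : ℝ) 1, ENNReal.ofReal (f z) < ⊤ :=
    (setLIntegral_mono' measurableSet_Ioo fun z hz =>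
      ENNReal.ofReal_le_ofReal (hle z hz)).trans_lt hg.lintegral_lt_top
  have h2 : ∫⁻ z in Ioo (0 : ℝ) 1, ENNReal.ofReal (-f z) = ⊤ := by
    by_contra hne
    refine hnot ⟨hf.aestronglyMeasurable, ?_⟩
    have h3 : ∀ x : ℝ, ‖x‖ₑ ≤ ENNReal.ofReal x + ENNReal.ofReal (-x) := fun x => by
      rw [Real.enorm_eq_ofReal_abs, abs_eq_max_neg, ENNReal.ofReal_max]
      exact max_le le_self_add le_add_self
    calc ∫⁻ z in Ioo (0 : ℝ) 1, ‖f z‖ₑ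
        ≤ ∫⁻ z in Ioo (0 : ℝ) 1, (ENNReal.ofReal (f z) + ENNReal.ofReal (-f z)) :=
          lintegral_mono fun z => h3 (f z)
      _ = (∫⁻ z in Ioo (0 : ℝ) 1, ENNReal.ofReal (f z))
          + ∫⁻ z in Ioo (0 : ℝ) 1, ENNReal.ofReal (-f z) :=
          lintegral_add_left' hf.ennreal_ofReal _
      _ < ⊤ := ENNReal.add_lt_top.2 ⟨h1, lt_top_iff_ne_top.2 hne⟩
  rw [extIntegral, h2, EReal.coe_ennreal_top, EReal.sub_top]

/-- Left-continuous functions that agree almost everywhere agree everywhere. -/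
lemma eqOn_of_ae_eq_of_leftContinuous {f g : ℝ → ℝ}
    (hf : ∀ z ∈ Ioo (0 : ℝ) 1, ContinuousWithinAt f (Iic z) z)
    (hg : ∀ z ∈ Ioo (0 : ℝ) 1, ContinuousWithinAt g (Iic z) z)
    (h : ∀ᵐ z ∂volume.restrict (Ioo (0 : ℝ) 1), f z = g z) : EqOn f g (Ioo 0 1) := by
  intro z hz
  have hf' : Tendsto f (𝓝[<] z) (𝓝 (f z)) :=
    (hf z hz).tendsto.mono_left (nhdsWithin_mono _ Iio_subset_Iic_self)
  have hg' : Tendsto g (𝓝[<] z) (𝓝 (g z)) :=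
    (hg z hz).tendsto.mono_left (nhdsWithin_mono _ Iio_subset_Iic_self)
  refine tendsto_nhds_unique_of_frequently_eq hf' hg' fun hne => ?_
  obtain ⟨l, hl, hl'⟩ := (mem_nhdsLT_iff_exists_Ioo_subset' hz.1).1 hne
  have hlz : max l 0 < z := max_lt hl hz.1
  have h2 : ∀ᵐ x ∂volume.restrict (Ioo (max l 0) z), f x = g x :=
    ae_mono (Measure.restrict_mono_set _ (Ioo_subset_Ioo (le_max_right _ _) hz.2.le)) h
  have hnb : (ae (volume.restrict (Ioo (max l 0) z))).NeBot := by
    rw [ae_neBot, Ne, Measure.restrict_eq_zero, Real.volume_Ioo, ENNReal.ofReal_eq_zero]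
    linarith
  obtain ⟨x, hx, hx'⟩ := (h2.and (ae_restrict_mem measurableSet_Ioo)).exists
  exact hl' ⟨(le_max_left _ _).trans_lt hx'.1, hx'.2⟩ hx

/-! ### Optimality -/

/-- The integrand of the auxiliary problem, where `a = λ / α`. -/
noncomputable def auxIntegrand (U q : ℝ → ℝ) (ℓ α a ν : ℝ) (H : ℝ → ℝ) (z : ℝ) : ℝ :=
  U (H z + ℓ) - ν * H z * (q z - if z ≤ α then a else 0)

/-- `G` is the demand at the price `ν` times the slope of the envelope determined by the point
`(b, c)` of the tangency curve, with finite cost and finite expected utility. -/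
structure IsEnvelopeDemand (U q : ℝ → ℝ) (ℓ α b c ν : ℝ) (G : ℝ → ℝ) : Prop where
  pos : 0 < c
  le : c ≤ q α
  le' : q α ≤ b
  gap_eq : lowerGap q α b = upperGap q α c
  multiplier_pos : 0 < ν
  eqOn : EqOn G (fun z => excessDemand U ℓ (ν * envelopeSlope (b - c) c (q z))) (Ioo 0 1)
  integrableOn_cost : IntegrableOn (fun z => G z * q z) (Ioo 0 1)
  integrableOn_utility : IntegrableOn (fun z => U (G z + ℓ)) (Ioo 0 1)

section Optimality

variable {U q G H : ℝ → ℝ} {ℓ α a b c ν : ℝ}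

lemma IsUtility.aemeasurable_comp (hU : IsUtility U) (hℓ : 0 ≤ ℓ) (hH : IsQuantile H) :
    AEMeasurable (fun z => U (H z + ℓ)) (volume.restrict (Ioo 0 1)) :=
  aemeasurable_restrict_of_monotoneOn measurableSet_Ioo fun x hx y hy hxy =>
    hU.strictMonoOn.monotoneOn (add_nonneg (hH.1 x hx) hℓ) (add_nonneg (hH.1 y hy) hℓ)
      (add_le_add_left (hH.2.1 hx hy hxy) ℓ)

lemma IsQuantile.aemeasurable (hH : IsQuantile H) :
    AEMeasurable H (volume.restrict (Ioo 0 1)) :=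
  aemeasurable_restrict_of_monotoneOn measurableSet_Ioo hH.2.1

lemma IsUtility.aemeasurable_auxIntegrand (hU : IsUtility U) (hℓ : 0 ≤ ℓ) (hq : IsKernel q)
    (hH : IsQuantile H) :
    AEMeasurable (auxIntegrand U q ℓ α a ν H) (volume.restrict (Ioo 0 1)) := by
  have h1 := hU.aemeasurable_comp hℓ hH
  have h2 := hH.aemeasurable
  have h3 := hq.integrableOn.aemeasurable
  have h4 : Measurable fun z : ℝ => if z ≤ α then a else 0 :=
    Measurable.ite measurableSet_Iic measurable_const measurable_const
  exact h1.sub ((h2.const_mul ν).mul (h3.sub h4.aemeasurable))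

lemma IsQuantile.integral_auxIntegrand (hH : IsQuantile H) (hα : α ∈ Ioo (0 : ℝ) 1)
    (hHq : IntegrableOn (fun z => H z * q z) (Ioo 0 1))
    (hHU : IntegrableOn (fun z => U (H z + ℓ)) (Ioo 0 1)) :
    IntegrableOn (auxIntegrand U q ℓ α a ν H) (Ioo 0 1) ∧
    ∫ z in Ioo (0 : ℝ) 1, auxIntegrand U q ℓ α a ν H z
      = (∫ z in Ioo (0 : ℝ) 1, U (H z + ℓ)) - ν * ((∫ z in Ioo (0 : ℝ) 1, H z * q z)
        - a * ∫ z in Ioo 0 α, H z) := by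
  have h1 : auxIntegrand U q ℓ α a ν H = fun z => U (H z + ℓ)
      - ν * (H z * q z - H z * (if z ≤ α then a else 0)) := by
    ext z
    rw [auxIntegrand]
    ring
  have h2 := integrableOn_mul_indicator_tail hα hH.2.1 hH.1 a
  have h3 : IntegrableOn (fun z => ν * (H z * q z - H z * (if z ≤ α then a else 0)))
      (Ioo 0 1) := (hHq.sub h2).const_mul ν
  rw [h1]
  refine ⟨hHU.sub h3, ?_⟩
  rw [integral_sub hHU h3, integral_const_mul, integral_sub hHq h2,
    integral_mul_indicator_tail hα]

namespace IsEnvelopeDemand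

lemma apply_eq (hG : IsEnvelopeDemand U q ℓ α b c ν G) {z : ℝ} (hz : z ∈ Ioo (0 : ℝ) 1) :
    G z = excessDemand U ℓ (ν * envelopeSlope (b - c) c (q z)) :=
  hG.eqOn hz

lemma isPrice (hG : IsEnvelopeDemand U q ℓ α b c ν G)
    (hq : IsKernel q) : IsPrice q fun z => envelopeSlope (b - c) c (q z) :=
  hq.isPrice_envelopeSlope (by linarith [hG.le, hG.le']) hG.pos

lemma isQuantile (hG : IsEnvelopeDemand U q ℓ α b c ν G)
    (hU : IsUtility U) (hℓ : 0 ≤ ℓ) (hq : IsKernel q) : IsQuantile G := by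
  have hW := hU.isDemand hℓ
  refine ⟨fun z hz => ?_, ?_, fun z hz => ?_⟩
  · rw [hG.eqOn hz]
    exact hW.nonneg _
  · exact ((hG.isPrice hq).monotoneOn_demand hW hG.multiplier_pos).congr hG.eqOn.symm
  · have hqz : ContinuousAt q z := hq.continuousOn.continuousAt (isOpen_Ioo.mem_nhds hz)
    have hs : ContinuousAt (fun z => ν * envelopeSlope (b - c) c (q z)) z := by
      unfold envelopeSlope
      exact continuousAt_const.mul
        (ContinuousAt.sup (hqz.sub continuousAt_const) (continuousAt_const.inf hqz))
    have hpos : 0 < ν * envelopeSlope (b - c) c (q z) :=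
      mul_pos hG.multiplier_pos ((hG.isPrice hq).pos z hz)
    have h1 : ContinuousAt (fun z => excessDemand U ℓ (ν * envelopeSlope (b - c) c (q z))) z :=
      (hW.continuousOn.continuousAt (Ioi_mem_nhds hpos)).comp
        (f := fun z => ν * envelopeSlope (b - c) c (q z)) hs
    exact (h1.congr (hG.eqOn.symm.eventuallyEq_of_mem
      (isOpen_Ioo.mem_nhds hz))).continuousWithinAt

/-- The integrand of the auxiliary problem after the slope of `φ_λ` has been replaced by the
slope of its envelope, at its pointwise maximizer. -/
lemma integrableOn_max (hG : IsEnvelopeDemand U q ℓ α b c ν G)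
    (hU : IsUtility U) (hℓ : 0 ≤ ℓ) (hq : IsKernel q) :
    IntegrableOn (fun z => U (G z + ℓ) - ν * envelopeSlope (b - c) c (q z) * G z)
      (Ioo 0 1) := by
  have hGQ := hG.isQuantile hU hℓ hq
  refine hG.integrableOn_utility.sub ((hG.integrableOn_cost.const_mul ν).mono' ?_ ?_)
  · exact ((((aemeasurable_restrict_of_antitoneOn measurableSet_Ioo
      (hG.isPrice hq).antitoneOn).const_mul ν)).mul hGQ.aemeasurable).aestronglyMeasurable
  · filter_upwards [ae_restrict_mem measurableSet_Ioo] with z hz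
    have hp := (hG.isPrice hq).pos z hz
    have hple := (hG.isPrice hq).le z hz
    have hG0 := hGQ.1 z hz
    have hν := hG.multiplier_pos
    rw [Real.norm_eq_abs, abs_of_nonneg (by positivity), mul_assoc, mul_comm (G z)]
    gcongr

lemma auxIntegrand_le (hG : IsEnvelopeDemand U q ℓ α b c ν G)
    (hU : IsUtility U) (hℓ : 0 ≤ ℓ) (hq : IsKernel q)
    (hα : α ∈ Ioo (0 : ℝ) 1) (hH : IsQuantile H) {z : ℝ} (hz : z ∈ Ioo (0 : ℝ) 1) :
    auxIntegrand U q ℓ α (b - c) ν H z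
      ≤ (U (G z + ℓ) - ν * envelopeSlope (b - c) c (q z) * G z)
        - ν * (H z * slopeGap q α b c z) ∧
    (auxIntegrand U q ℓ α (b - c) ν H z
      = (U (G z + ℓ) - ν * envelopeSlope (b - c) c (q z) * G z)
        - ν * (H z * slopeGap q α b c z) → H z = G z) := by
  have hp := mul_pos hG.multiplier_pos ((hG.isPrice hq).pos z hz)
  have hgap := hq.slopeGap_eq hα hG.le hG.le' hz
  have h1 : auxIntegrand U q ℓ α (b - c) ν H z
      = (U (H z + ℓ) - ν * envelopeSlope (b - c) c (q z) * H z)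
        - ν * (H z * slopeGap q α b c z) := by
    rw [hgap, auxIntegrand]
    ring
  by_cases hne : H z = G z
  · exact ⟨by rw [h1, hne], fun _ => hne⟩
  · have h2 := hU.lt_excessDemand hℓ hp (hH.1 z hz) (by rwa [← hG.apply_eq hz])
    rw [← hG.apply_eq hz] at h2
    exact ⟨by rw [h1]; linarith, fun h => by rw [h1] at h; linarith⟩

lemma integrableOn_bound (hG : IsEnvelopeDemand U q ℓ α b c ν G)
    (hU : IsUtility U) (hℓ : 0 ≤ ℓ) (hq : IsKernel q)
    (hα : α ∈ Ioo (0 : ℝ) 1) (hH : IsQuantile H) :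
    IntegrableOn (fun z => (U (G z + ℓ) - ν * envelopeSlope (b - c) c (q z) * G z)
        - ν * (H z * slopeGap q α b c z)) (Ioo 0 1) :=
  (hG.integrableOn_max hU hℓ hq).sub
    ((hq.integrableOn_mul_slopeGap hα hG.pos hG.le hH.2.1 hH.1).const_mul ν)

lemma integral_bound_le (hG : IsEnvelopeDemand U q ℓ α b c ν G)
    (hU : IsUtility U) (hℓ : 0 ≤ ℓ) (hq : IsKernel q)
    (hα : α ∈ Ioo (0 : ℝ) 1) (hH : IsQuantile H) :
    ∫ z in Ioo (0 : ℝ) 1, ((U (G z + ℓ) - ν * envelopeSlope (b - c) c (q z) * G z)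
        - ν * (H z * slopeGap q α b c z))
      ≤ ∫ z in Ioo (0 : ℝ) 1, (U (G z + ℓ) - ν * envelopeSlope (b - c) c (q z) * G z) := by
  rw [integral_sub (hG.integrableOn_max hU hℓ hq)
    ((hq.integrableOn_mul_slopeGap hα hG.pos hG.le hH.2.1 hH.1).const_mul ν), integral_const_mul]
  have := mul_nonneg hG.multiplier_pos.le
    (hq.integral_mul_slopeGap_nonneg hα hG.pos hG.le hG.gap_eq hH.2.1 hH.1)
  linarith

lemma auxIntegrand_self (hG : IsEnvelopeDemand U q ℓ α b c ν G)
    (hq : IsKernel q) (hα : α ∈ Ioo (0 : ℝ) 1) :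
    EqOn (auxIntegrand U q ℓ α (b - c) ν G)
      (fun z => (U (G z + ℓ) - ν * envelopeSlope (b - c) c (q z) * G z)
        - ν * (G z * slopeGap q α b c z)) (Ioo 0 1) := by
  intro z hz
  simp only [hq.slopeGap_eq hα hG.le hG.le' hz, auxIntegrand]
  ring

lemma integrableOn_auxIntegrand (hG : IsEnvelopeDemand U q ℓ α b c ν G)
    (hU : IsUtility U) (hℓ : 0 ≤ ℓ) (hq : IsKernel q)
    (hα : α ∈ Ioo (0 : ℝ) 1) : IntegrableOn (auxIntegrand U q ℓ α (b - c) ν G) (Ioo 0 1) :=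
  (hG.integrableOn_bound hU hℓ hq hα (hG.isQuantile hU hℓ hq)).congr_fun
    (hG.auxIntegrand_self hq hα).symm measurableSet_Ioo

lemma integral_auxIntegrand (hG : IsEnvelopeDemand U q ℓ α b c ν G)
    (hU : IsUtility U) (hℓ : 0 ≤ ℓ) (hq : IsKernel q)
    (hα : α ∈ Ioo (0 : ℝ) 1) :
    ∫ z in Ioo (0 : ℝ) 1, auxIntegrand U q ℓ α (b - c) ν G z
      = ∫ z in Ioo (0 : ℝ) 1, (U (G z + ℓ) - ν * envelopeSlope (b - c) c (q z) * G z) := by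
  have hGQ := hG.isQuantile hU hℓ hq
  have h0 : ∫ z in Ioo (0 : ℝ) 1, G z * slopeGap q α b c z = 0 := by
    refine (setIntegral_congr_fun measurableSet_Ioo fun z hz => ?_).trans
      (hq.integral_comp_mul_slopeGap hα hG.le hG.le' hG.gap_eq fun x => excessDemand U ℓ (ν * x))
    simp only [hG.apply_eq hz]
  rw [setIntegral_congr_fun measurableSet_Ioo (hG.auxIntegrand_self hq hα),
    integral_sub (hG.integrableOn_max hU hℓ hq)
    ((hq.integrableOn_mul_slopeGap hα hG.pos hG.le hGQ.2.1 hGQ.1).const_mul ν),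
    integral_const_mul, h0, mul_zero, sub_zero]

lemma extIntegral_le (hG : IsEnvelopeDemand U q ℓ α b c ν G)
    (hU : IsUtility U) (hℓ : 0 ≤ ℓ) (hq : IsKernel q)
    (hα : α ∈ Ioo (0 : ℝ) 1) (hH : IsQuantile H) :
    extIntegral (auxIntegrand U q ℓ α (b - c) ν H)
      ≤ extIntegral (auxIntegrand U q ℓ α (b - c) ν G) := by
  by_cases hi : IntegrableOn (auxIntegrand U q ℓ α (b - c) ν H) (Ioo 0 1)
  · rw [extIntegral_of_integrableOn hi,
      extIntegral_of_integrableOn (hG.integrableOn_auxIntegrand hU hℓ hq hα),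
      EReal.coe_le_coe_iff, hG.integral_auxIntegrand hU hℓ hq hα]
    exact (setIntegral_mono_on hi (hG.integrableOn_bound hU hℓ hq hα hH) measurableSet_Ioo
      fun z hz => (hG.auxIntegrand_le hU hℓ hq hα hH hz).1).trans
      (hG.integral_bound_le hU hℓ hq hα hH)
  · rw [extIntegral_eq_bot (hU.aemeasurable_auxIntegrand hℓ hq hH)
      (hG.integrableOn_bound hU hℓ hq hα hH)
      (fun z hz => (hG.auxIntegrand_le hU hℓ hq hα hH hz).1) hi]
    exact bot_le

lemma eqOn_of_extIntegral_eq (hG : IsEnvelopeDemand U q ℓ α b c ν G)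
    (hU : IsUtility U) (hℓ : 0 ≤ ℓ) (hq : IsKernel q)
    (hα : α ∈ Ioo (0 : ℝ) 1) (hH : IsQuantile H)
    (heq : extIntegral (auxIntegrand U q ℓ α (b - c) ν H)
      = extIntegral (auxIntegrand U q ℓ α (b - c) ν G)) : EqOn H G (Ioo 0 1) := by
  have hle := fun z hz => (hG.auxIntegrand_le hU hℓ hq hα hH (z := z) hz).1
  have hbd := hG.integrableOn_bound hU hℓ hq hα hH
  rw [extIntegral_of_integrableOn (hG.integrableOn_auxIntegrand hU hℓ hq hα)] at heq
  have hi : IntegrableOn (auxIntegrand U q ℓ α (b - c) ν H) (Ioo 0 1) := by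
    by_contra hi
    rw [extIntegral_eq_bot (hU.aemeasurable_auxIntegrand hℓ hq hH) hbd hle hi] at heq
    exact EReal.bot_ne_coe _ heq
  rw [extIntegral_of_integrableOn hi, EReal.coe_eq_coe_iff,
    hG.integral_auxIntegrand hU hℓ hq hα] at heq
  have h1 := setIntegral_mono_on hi hbd measurableSet_Ioo hle
  have h2 := hG.integral_bound_le hU hℓ hq hα hH
  have hae : ∀ᵐ z ∂volume.restrict (Ioo (0 : ℝ) 1), auxIntegrand U q ℓ α (b - c) ν H z
      ≤ (U (G z + ℓ) - ν * envelopeSlope (b - c) c (q z) * G z)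
        - ν * (H z * slopeGap q α b c z) := by
    filter_upwards [ae_restrict_mem measurableSet_Ioo] with z hz using hle z hz
  have h3 := (integral_eq_iff_of_ae_le hi hbd hae).1 (le_antisymm h1 (by linarith))
  refine eqOn_of_ae_eq_of_leftContinuous hH.2.2 (hG.isQuantile hU hℓ hq).2.2 ?_
  filter_upwards [h3, ae_restrict_mem measurableSet_Ioo] with z hz hz'
  exact (hG.auxIntegrand_le hU hℓ hq hα hH hz').2 hz

/-- A demand function is the unique solution of the auxiliary problem. -/
theorem isUniqueMaximizer_aux (hG : IsEnvelopeDemand U q ℓ α b c ν G)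
    (hU : IsUtility U) (hℓ : 0 ≤ ℓ) (hq : IsKernel q)
    (hα : α ∈ Ioo (0 : ℝ) 1) (k : ℝ) :
    IsUniqueMaximizer IsQuantile
      (fun H => extIntegral (auxIntegrand U q ℓ α (b - c) ν H) + (k : EReal)) G := by
  have hval := extIntegral_of_integrableOn (hG.integrableOn_auxIntegrand hU hℓ hq hα)
  refine ⟨hG.isQuantile hU hℓ hq, ?_, ?_, fun H hH => ?_, fun H hH heq => ?_⟩
  · simp only [hval, ← EReal.coe_add]
    exact EReal.coe_ne_top _
  · simp only [hval, ← EReal.coe_add]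
    exact EReal.coe_ne_bot _
  · exact add_le_add_left (hG.extIntegral_le hU hℓ hq hα hH) _
  · refine hG.eqOn_of_extIntegral_eq hU hℓ hq hα hH ?_
    have h1 := congrArg (fun x => x - (k : EReal)) heq
    simpa only [EReal.add_sub_cancel_right] using h1

/-- A demand function for which both constraints bind is the unique solution of the quantile
problem: on the feasible set, the objective is at most that of the auxiliary problem. -/
theorem isUniqueMaximizer_quantile (hG : IsEnvelopeDemand U q ℓ α b c ν G)
    (hU : IsUtility U) (hℓ : 0 ≤ ℓ) (hq : IsKernel q)
    (hα : α ∈ Ioo (0 : ℝ) 1) {zbar zlow : ℝ}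
    (hbar : ∫ z in Ioo (0 : ℝ) 1, G z * q z = zbar)
    (hlow : 1 / α * ∫ z in Ioo 0 α, G z = zlow) :
    IsUniqueMaximizer (fun H => IsQuantile H ∧ IntegrableOn (fun z => H z * q z) (Ioo 0 1) ∧
        ∫ z in Ioo (0 : ℝ) 1, H z * q z ≤ zbar ∧ zlow ≤ 1 / α * ∫ z in Ioo 0 α, H z)
      (quantileObjective U ℓ) G := by
  have hGQ := hG.isQuantile hU hℓ hq
  have hα0 := hα.1
  have key : ∀ H, IsQuantile H → IntegrableOn (fun z => H z * q z) (Ioo 0 1) →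
      ∫ z in Ioo (0 : ℝ) 1, H z * q z ≤ zbar → zlow ≤ 1 / α * ∫ z in Ioo 0 α, H z →
      IntegrableOn (fun z => U (H z + ℓ)) (Ioo 0 1) ∧
      (∫ z in Ioo (0 : ℝ) 1, U (H z + ℓ)) - ∫ z in Ioo (0 : ℝ) 1, U (G z + ℓ)
        ≤ (∫ z in Ioo (0 : ℝ) 1, auxIntegrand U q ℓ α (b - c) ν H z)
          - ∫ z in Ioo (0 : ℝ) 1, auxIntegrand U q ℓ α (b - c) ν G z := by
    intro H hH hHq hHbar hHlow
    have hHU : IntegrableOn (fun z => U (H z + ℓ)) (Ioo 0 1) := by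
      refine ((hG.integrableOn_max hU hℓ hq).add (hHq.const_mul ν)).mono'
        (hU.aemeasurable_comp hℓ hH).aestronglyMeasurable ?_
      filter_upwards [ae_restrict_mem measurableSet_Ioo] with z hz
      have hp := (hG.isPrice hq).pos z hz
      have hple := (hG.isPrice hq).le z hz
      have hν := hG.multiplier_pos
      have hHz := hH.1 z hz
      rw [Real.norm_eq_abs, abs_of_nonneg (hU.nonneg _ (add_nonneg hHz hℓ))]
      have h1 : U (H z + ℓ) - ν * envelopeSlope (b - c) c (q z) * H z
          ≤ U (G z + ℓ) - ν * envelopeSlope (b - c) c (q z) * G z := by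
        by_cases hne : H z = G z
        · rw [hne]
        · have := hU.lt_excessDemand hℓ (mul_pos hν hp) hHz (by rwa [← hG.apply_eq hz])
          rw [← hG.apply_eq hz] at this
          exact this.le
      have h2 : ν * envelopeSlope (b - c) c (q z) * H z ≤ ν * (H z * q z) := by
        rw [mul_assoc, mul_comm (H z)]
        gcongr
      simp only [Pi.add_apply]
      linarith
    refine ⟨hHU, ?_⟩
    rw [(hH.integral_auxIntegrand hα hHq hHU).2,
      (hGQ.integral_auxIntegrand hα hG.integrableOn_cost hG.integrableOn_utility).2, hbar]
    have h1 : ∫ z in Ioo 0 α, G z ≤ ∫ z in Ioo 0 α, H z := by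
      rw [← hlow] at hHlow
      exact le_of_mul_le_mul_left hHlow (by positivity)
    have h2 : (b - c) * ∫ z in Ioo 0 α, G z ≤ (b - c) * ∫ z in Ioo 0 α, H z :=
      mul_le_mul_of_nonneg_left h1 (by linarith [hG.le, hG.le'])
    have h3 : 0 ≤ ν * ((zbar - (b - c) * ∫ z in Ioo 0 α, G z)
        - ((∫ z in Ioo (0 : ℝ) 1, H z * q z) - (b - c) * ∫ z in Ioo 0 α, H z)) :=
      mul_nonneg hG.multiplier_pos.le (by linarith)
    linarith
  have hval := extIntegral_of_integrableOn hG.integrableOn_utility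
  refine ⟨⟨hGQ, hG.integrableOn_cost, hbar.le, hlow.ge⟩, ?_, ?_, ?_, ?_⟩
  · rw [quantileObjective, hval]
    exact EReal.coe_ne_top _
  · rw [quantileObjective, hval]
    exact EReal.coe_ne_bot _
  · rintro H ⟨hH, hHq, hHbar, hHlow⟩
    obtain ⟨hHU, hle⟩ := key H hH hHq hHbar hHlow
    have h1 := hG.extIntegral_le hU hℓ hq hα hH
    rw [extIntegral_of_integrableOn (hH.integral_auxIntegrand hα hHq hHU).1,
      extIntegral_of_integrableOn (hG.integrableOn_auxIntegrand hU hℓ hq hα),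
      EReal.coe_le_coe_iff] at h1
    rw [quantileObjective, quantileObjective, hval, extIntegral_of_integrableOn hHU,
      EReal.coe_le_coe_iff]
    linarith
  · rintro H ⟨hH, hHq, hHbar, hHlow⟩ heq
    obtain ⟨hHU, hle⟩ := key H hH hHq hHbar hHlow
    rw [quantileObjective, quantileObjective, hval, extIntegral_of_integrableOn hHU,
      EReal.coe_eq_coe_iff] at heq
    refine hG.eqOn_of_extIntegral_eq hU hℓ hq hα hH
      (le_antisymm (hG.extIntegral_le hU hℓ hq hα hH) ?_)
    rw [extIntegral_of_integrableOn (hH.integral_auxIntegrand hα hHq hHU).1,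
      extIntegral_of_integrableOn (hG.integrableOn_auxIntegrand hU hℓ hq hα),
      EReal.coe_le_coe_iff]
    linarith

end IsEnvelopeDemand

end Optimality

/-! ### Geometry of the tangency curve -/

section Kernel

variable {q : ℝ → ℝ} {α : ℝ}

lemma IsKernel.intervalIntegrable (hq : IsKernel q) {x y : ℝ} (hx : x ∈ Icc (0 : ℝ) 1)
    (hy : y ∈ Icc (0 : ℝ) 1) : IntervalIntegrable q volume x y := by
  have h : IntervalIntegrable q volume 0 1 := by
    rw [intervalIntegrable_iff_integrableOn_Ioo_of_le zero_le_one]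
    exact hq.integrableOn
  refine h.mono_set ?_
  rw [uIcc_of_le (zero_le_one' ℝ)]
  exact uIcc_subset_Icc hx hy

lemma setIntegral_Ioo_eq {f : ℝ → ℝ} {x y : ℝ} (h : x ≤ y) :
    ∫ z in Ioo x y, f z = ∫ z in x..y, f z := by
  rw [intervalIntegral.integral_of_le h, integral_Ioc_eq_integral_Ioo]

lemma IsKernel.lowerGap_eq (hq : IsKernel q) (hα : α ∈ Ioo (0 : ℝ) 1) {w : ℝ}
    (hw : w ∈ Ioo (0 : ℝ) 1) (hwα : w ≤ α) :
    lowerGap q α (q w) = q w * (α - w) - ∫ y in w..α, q y := by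
  have h : ∀ z ∈ Ioo 0 α, max (q w - q z) 0 = (Ioo w α).indicator (fun z => q w - q z) z := by
    intro z hz
    have hz1 := Ioo_zero_subset hα hz
    rcases le_or_gt z w with h | h
    · rw [indicator_of_notMem fun h' => h'.1.not_ge h,
        max_eq_right (sub_nonpos.2 (hq.strictAntiOn.antitoneOn hz1 hw h))]
    · have hmem : z ∈ Ioo w α := ⟨h, hz.2⟩
      rw [indicator_of_mem hmem,
        max_eq_left (sub_nonneg.2 (hq.strictAntiOn hw hz1 h).le)]
  rw [lowerGap, setIntegral_congr_fun measurableSet_Ioo h, setIntegral_indicator measurableSet_Ioo,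
    inter_eq_self_of_subset_right (Ioo_subset_Ioo_left hw.1.le), setIntegral_Ioo_eq hwα,
    intervalIntegral.integral_sub intervalIntegrable_const
      (hq.intervalIntegrable (Ioo_subset_Icc_self hw) (Ioo_subset_Icc_self hα)),
    intervalIntegral.integral_const, smul_eq_mul, mul_comm]

lemma IsKernel.upperGap_eq (hq : IsKernel q) (hα : α ∈ Ioo (0 : ℝ) 1) {w : ℝ}
    (hw : w ∈ Ioo (0 : ℝ) 1) (hwα : α ≤ w) :
    upperGap q α (q w) = (∫ y in α..w, q y) - q w * (w - α) := by
  have h : ∀ z ∈ Ioo α 1, max (q z - q w) 0 = (Ioc α w).indicator (fun z => q z - q w) z := by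
    intro z hz
    have hz1 := Ioo_one_subset hα hz
    rcases le_or_gt z w with h | h
    · have hmem : z ∈ Ioc α w := ⟨hz.1, h⟩
      rw [indicator_of_mem hmem,
        max_eq_left (sub_nonneg.2 (hq.strictAntiOn.antitoneOn hz1 hw h))]
    · rw [indicator_of_notMem fun h' => h'.2.not_gt h,
        max_eq_right (sub_nonpos.2 (hq.strictAntiOn hw hz1 h).le)]
  have hsub : Ioc α w ⊆ Ioo α 1 := fun z hz => ⟨hz.1, hz.2.trans_lt hw.2⟩
  rw [upperGap, setIntegral_congr_fun measurableSet_Ioo h, setIntegral_indicator measurableSet_Ioc,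
    inter_eq_self_of_subset_right hsub,
    ← intervalIntegral.integral_of_le hwα,
    intervalIntegral.integral_sub
      (hq.intervalIntegrable (Ioo_subset_Icc_self hα) (Ioo_subset_Icc_self hw))
      intervalIntegrable_const,
    intervalIntegral.integral_const, smul_eq_mul, mul_comm (q w)]

lemma IsKernel.upperGap_zero (hq : IsKernel q) (hα : α ∈ Ioo (0 : ℝ) 1) :
    upperGap q α 0 = ∫ y in α..1, q y := by
  rw [← setIntegral_Ioo_eq hα.2.le, upperGap]
  refine setIntegral_congr_fun measurableSet_Ioo fun z hz => ?_
  simp only [sub_zero]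
  exact max_eq_left (hq.pos (Ioo_one_subset hα hz)).le

end Kernel

/-! ### Identification of the thresholds and of the optimizer for the log-normal law -/

section LogNormal

variable {m : ℝ} {v : ℝ≥0} {U b : ℝ → ℝ} {α ℓ ν : ℝ}

/-- The function `z ↦ F⁻¹(1 - z)` of a law. -/
noncomputable def upperQuantile (μ : Measure ℝ) (z : ℝ) : ℝ := quantile μ (1 - z)

lemma isKernel_upperQuantile (m : ℝ) {v : ℝ≥0} (hv : v ≠ 0) :
    IsKernel (upperQuantile (logNormal m v)) :=
  isKernel_quantile_logNormal hv

lemma one_sub_cdf_mem (hv : v ≠ 0) {x : ℝ} (hx : 0 < x) :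
    1 - cdf (logNormal m v) x ∈ Ioo (0 : ℝ) 1 := by
  have h := cdf_logNormal_mem (m := m) hv hx
  exact ⟨by linarith [h.2], by linarith [h.1]⟩

lemma upperQuantile_one_sub_cdf (hv : v ≠ 0) {x : ℝ} (hx : 0 < x) :
    upperQuantile (logNormal m v) (1 - cdf (logNormal m v) x) = x := by
  rw [upperQuantile, sub_sub_cancel, quantile_cdf_logNormal hv hx]

lemma le_one_sub_cdf_iff (hv : v ≠ 0) {x z : ℝ} (hx : 0 < x) (hz : z ∈ Ioo (0 : ℝ) 1) :
    z ≤ 1 - cdf (logNormal m v) x ↔ x ≤ upperQuantile (logNormal m v) z := by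
  rw [← (isKernel_upperQuantile m hv).strictAntiOn.le_iff_ge (one_sub_cdf_mem hv hx) hz,
    upperQuantile_one_sub_cdf hv hx]

lemma eta_eq (m : ℝ) (v : ℝ≥0) (α lam : ℝ) :
    eta (logNormal m v) α lam
      = -(∫ y in (1 - cdf (logNormal m v) (lam / α))..1, upperQuantile (logNormal m v) y)
        + lam / α * (α - (1 - cdf (logNormal m v) (lam / α))) := by
  rw [eta]
  congr 1
  ring

lemma eta_of_le (hv : v ≠ 0) (hα : α ∈ Ioo (0 : ℝ) 1) {lam : ℝ} (hlam : 0 < lam)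
    (h : upperQuantile (logNormal m v) α ≤ lam / α) :
    eta (logNormal m v) α lam = lowerGap (upperQuantile (logNormal m v)) α (lam / α)
      - upperGap (upperQuantile (logNormal m v)) α 0 := by
  have hq := isKernel_upperQuantile m hv
  have hx : 0 < lam / α := div_pos hlam hα.1
  have hw := one_sub_cdf_mem (m := m) hv hx
  have hqw := upperQuantile_one_sub_cdf (m := m) hv hx
  rw [eta_eq m v α lam]
  set w := 1 - cdf (logNormal m v) (lam / α)
  have hwα : w ≤ α := (hq.strictAntiOn.le_iff_ge hα hw).1 (by rwa [hqw])
  have h1 := hq.lowerGap_eq hα hw hwα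
  rw [hqw] at h1
  have hadj := intervalIntegral.integral_add_adjacent_intervals
    (hq.intervalIntegrable (Ioo_subset_Icc_self hw) (Ioo_subset_Icc_self hα))
    (hq.intervalIntegrable (Ioo_subset_Icc_self hα) (right_mem_Icc.2 zero_le_one))
  rw [h1, hq.upperGap_zero hα, ← hadj]
  ring

lemma eta_neg_of_lt (hv : v ≠ 0) (hα : α ∈ Ioo (0 : ℝ) 1) {lam : ℝ} (hlam : 0 < lam)
    (h : lam / α < upperQuantile (logNormal m v) α) : eta (logNormal m v) α lam < 0 := by
  have hq := isKernel_upperQuantile m hv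
  have hx : 0 < lam / α := div_pos hlam hα.1
  have hw := one_sub_cdf_mem (m := m) hv hx
  have hqw := upperQuantile_one_sub_cdf (m := m) hv hx
  rw [eta_eq m v α lam]
  set w := 1 - cdf (logNormal m v) (lam / α)
  have hwα : α < w := (hq.strictAntiOn.lt_iff_gt hw hα).1 (by rwa [hqw])
  have h1 : 0 ≤ ∫ y in w..1, upperQuantile (logNormal m v) y := by
    rw [← setIntegral_Ioo_eq hw.2.le]
    exact setIntegral_nonneg measurableSet_Ioo fun z hz => (hq.pos ⟨hw.1.trans hz.1, hz.2⟩).le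
  have h2 : 0 < lam / α * (w - α) := mul_pos hx (by linarith)
  linarith

/-- The left end of the tangency curve, where the envelope has slope `0`, is `λ̂`. -/
lemma lamHat_eq (hv : v ≠ 0) (hα : α ∈ Ioo (0 : ℝ) 1)
    (hb : IsTangency (upperQuantile (logNormal m v)) α b) :
    lamHat (logNormal m v) α = α * b 0 := by
  have hq := isKernel_upperQuantile m hv
  have hqα := hq.pos hα
  have h0 : (0 : ℝ) ∈ Icc 0 (upperQuantile (logNormal m v) α) := ⟨le_rfl, hqα.le⟩
  have hb0 := hb.le 0 h0
  have hdiv : α * b 0 / α = b 0 := mul_div_cancel_left₀ _ hα.1.ne'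
  have hset : {lam : ℝ | 0 < lam ∧ eta (logNormal m v) α lam = 0} = {α * b 0} := by
    ext lam
    simp only [mem_ofPred_eq, mem_singleton_iff]
    constructor
    · rintro ⟨hlam, heta⟩
      rcases lt_or_ge (lam / α) (upperQuantile (logNormal m v) α) with h | h
      · exact absurd heta (eta_neg_of_lt hv hα hlam h).ne
      · rw [eta_of_le hv hα hlam h, ← hb.eq 0 h0, sub_eq_zero] at heta
        have : lam / α = b 0 := by
          rcases lt_trichotomy (lam / α) (b 0) with h1 | h1 | h1
          · exact absurd heta (hq.lowerGap_lt hα h h1).ne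
          · exact h1
          · exact absurd heta (hq.lowerGap_lt hα hb0 h1).ne'
        rw [← this, mul_div_cancel₀ _ hα.1.ne']
    · rintro rfl
      have hpos := mul_pos hα.1 (hqα.trans_le hb0)
      refine ⟨hpos, ?_⟩
      rw [eta_of_le hv hα hpos (by rwa [hdiv]), hdiv, hb.eq 0 h0, sub_self]
  rw [lamHat, hset, csInf_singleton]

/-- The tangency equation in terms of `F⁻¹(1 - z) = x` and `F⁻¹(1 - s(z)) = x + λ / α`. -/
lemma tangency_eq (hv : v ≠ 0) (hα : α ∈ Ioo (0 : ℝ) 1) {lam z : ℝ} (hlam : 0 < lam)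
    (hz : z ∈ Ioo α 1)
    (h : upperQuantile (logNormal m v) α ≤ upperQuantile (logNormal m v) z + lam / α) :
    phi (logNormal m v) α lam z - phi (logNormal m v) α lam (sMap (logNormal m v) α lam z)
      - phi' (logNormal m v) α lam z * (z - sMap (logNormal m v) α lam z)
    = upperGap (upperQuantile (logNormal m v)) α (upperQuantile (logNormal m v) z)
      - lowerGap (upperQuantile (logNormal m v)) α
        (upperQuantile (logNormal m v) z + lam / α) := by
  have hq := isKernel_upperQuantile m hv
  have hz1 := Ioo_one_subset hα hz
  have hy : 0 < upperQuantile (logNormal m v) z + lam / α :=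
    add_pos (hq.pos hz1) (div_pos hlam hα.1)
  have hs := one_sub_cdf_mem (m := m) hv hy
  have hqs := upperQuantile_one_sub_cdf (m := m) hv hy
  have hsdef : sMap (logNormal m v) α lam z
      = 1 - cdf (logNormal m v) (upperQuantile (logNormal m v) z + lam / α) := rfl
  rw [← hsdef] at hs hqs
  set s := sMap (logNormal m v) α lam z
  have hsα : s ≤ α := (hq.strictAntiOn.le_iff_ge hα hs).1 (by rwa [hqs])
  have h1 := hq.lowerGap_eq hα hs hsα
  rw [hqs] at h1
  rw [h1, hq.upperGap_eq hα hz1 hz.1.le, phi, phi, phi', if_neg (not_le.2 hz.1), if_pos hsα,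
    if_neg (not_le.2 hz.1)]
  change -(∫ y in z..1, upperQuantile (logNormal m v) y) + 0
    - (-(∫ y in s..1, upperQuantile (logNormal m v) y) + lam * ((α - s) / α))
    - (upperQuantile (logNormal m v) z - 0) * (z - s) = _
  have hα' := Ioo_subset_Icc_self hα
  have hs' := Ioo_subset_Icc_self hs
  have hz' := Ioo_subset_Icc_self hz1
  have h1' : (1 : ℝ) ∈ Icc (0 : ℝ) 1 := right_mem_Icc.2 zero_le_one
  have hadj := intervalIntegral.integral_add_adjacent_intervals
    (hq.intervalIntegrable hs' hα') (hq.intervalIntegrable hα' h1')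
  have hadj2 := intervalIntegral.integral_add_adjacent_intervals
    (hq.intervalIntegrable hα' hz') (hq.intervalIntegrable hz' h1')
  rw [← hadj, ← hadj2]
  ring

lemma tangency_pos (hv : v ≠ 0) (hα : α ∈ Ioo (0 : ℝ) 1) {lam z : ℝ} (hlam : 0 < lam)
    (hz : z ∈ Ioo α 1)
    (h : upperQuantile (logNormal m v) z + lam / α < upperQuantile (logNormal m v) α) :
    0 < phi (logNormal m v) α lam z - phi (logNormal m v) α lam (sMap (logNormal m v) α lam z)
      - phi' (logNormal m v) α lam z * (z - sMap (logNormal m v) α lam z) := by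
  have hq := isKernel_upperQuantile m hv
  have hz1 := Ioo_one_subset hα hz
  have hlα := div_pos hlam hα.1
  have hy : 0 < upperQuantile (logNormal m v) z + lam / α := add_pos (hq.pos hz1) hlα
  have hs := one_sub_cdf_mem (m := m) hv hy
  have hqs := upperQuantile_one_sub_cdf (m := m) hv hy
  have hsdef : sMap (logNormal m v) α lam z
      = 1 - cdf (logNormal m v) (upperQuantile (logNormal m v) z + lam / α) := rfl
  rw [← hsdef] at hs hqs
  set s := sMap (logNormal m v) α lam z
  have hsα : α < s := (hq.strictAntiOn.lt_iff_gt hs hα).1 (by rwa [hqs])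
  have hsz : s < z := (hq.strictAntiOn.lt_iff_gt hz1 hs).1 (by linarith)
  rw [phi, phi, phi', if_neg (not_le.2 hz.1), if_neg (not_le.2 hsα), if_neg (not_le.2 hz.1)]
  change 0 < -(∫ y in z..1, upperQuantile (logNormal m v) y) + 0
    - (-(∫ y in s..1, upperQuantile (logNormal m v) y) + 0)
    - (upperQuantile (logNormal m v) z - 0) * (z - s)
  have hs' := Ioo_subset_Icc_self hs
  have hz' := Ioo_subset_Icc_self hz1
  have hadj := intervalIntegral.integral_add_adjacent_intervals
    (hq.intervalIntegrable hs' hz') (hq.intervalIntegrable hz' (right_mem_Icc.2 zero_le_one))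
  have hpos : 0 < ∫ y in s..z, (upperQuantile (logNormal m v) y
      - upperQuantile (logNormal m v) z) := by
    refine intervalIntegral.intervalIntegral_pos_of_pos_on
      ((hq.intervalIntegrable hs' hz').sub intervalIntegrable_const) (fun y hy => ?_) hsz
    exact sub_pos.2 (hq.strictAntiOn ⟨hs.1.trans hy.1, hy.2.trans hz1.2⟩ hz1 hy.2)
  rw [intervalIntegral.integral_sub (hq.intervalIntegrable hs' hz') intervalIntegrable_const,
    intervalIntegral.integral_const, smul_eq_mul] at hpos
  rw [← hadj]
  linarith

/-- The point `z₂` for the multiplier `λ = α (b c - c)` is determined by `F⁻¹(1 - z₂) = c`. -/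
lemma zTwo_eq (hv : v ≠ 0) (hα : α ∈ Ioo (0 : ℝ) 1)
    (hb : IsTangency (upperQuantile (logNormal m v)) α b) {c : ℝ}
    (hc : c ∈ Ioo 0 (upperQuantile (logNormal m v) α)) :
    zTwo (logNormal m v) α (α * (b c - c)) = 1 - cdf (logNormal m v) c := by
  have hq := isKernel_upperQuantile m hv
  have hc' := Ioo_subset_Icc_self hc
  have hbc := hb.le c hc'
  have hlam : 0 < α * (b c - c) := mul_pos hα.1 (by linarith [hc.2])
  have hdiv : α * (b c - c) / α = b c - c := mul_div_cancel_left₀ _ hα.1.ne'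
  have hw := one_sub_cdf_mem (m := m) hv hc.1
  have hqw := upperQuantile_one_sub_cdf (m := m) hv hc.1
  have hset : {z : ℝ | z ∈ Ioo α 1 ∧ phi (logNormal m v) α (α * (b c - c)) z
      - phi (logNormal m v) α (α * (b c - c)) (sMap (logNormal m v) α (α * (b c - c)) z)
      - phi' (logNormal m v) α (α * (b c - c)) z
        * (z - sMap (logNormal m v) α (α * (b c - c)) z) = 0}
      = {1 - cdf (logNormal m v) c} := by
    ext z
    simp only [mem_ofPred_eq, mem_singleton_iff]
    constructor
    · rintro ⟨hz, heq⟩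
      have hz1 := Ioo_one_subset hα hz
      have hx : upperQuantile (logNormal m v) z < upperQuantile (logNormal m v) α :=
        hq.strictAntiOn hα hz1 hz.1
      rcases lt_or_ge (upperQuantile (logNormal m v) z + α * (b c - c) / α)
        (upperQuantile (logNormal m v) α) with h | h
      · exact absurd heq (tangency_pos hv hα hlam hz h).ne'
      · rw [tangency_eq hv hα hlam hz h, sub_eq_zero, hdiv] at heq
        refine hq.strictAntiOn.injOn hz1 hw ?_
        rw [hqw]
        rcases lt_trichotomy (upperQuantile (logNormal m v) z) c with h1 | h1 | h1
        · have h2 := hq.upperGap_lt hα (hq.pos hz1).le h1 hc.2.le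
          rw [← hb.eq c hc'] at h2
          have h3 := hq.lowerGap_mono hα
            (by linarith : upperQuantile (logNormal m v) z + (b c - c) ≤ b c)
          linarith
        · exact h1
        · have h2 := hq.upperGap_lt hα hc.1.le h1 hx.le
          rw [← hb.eq c hc'] at h2
          have h3 := hq.lowerGap_mono hα
            (by linarith : b c ≤ upperQuantile (logNormal m v) z + (b c - c))
          linarith
    · rintro rfl
      have hz : 1 - cdf (logNormal m v) c ∈ Ioo α 1 :=
        ⟨(hq.strictAntiOn.lt_iff_gt hw hα).1 (by rw [hqw]; exact hc.2), hw.2⟩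
      refine ⟨hz, ?_⟩
      rw [tangency_eq hv hα hlam hz (by rw [hqw, hdiv]; linarith), hqw, hdiv, add_sub_cancel,
        hb.eq c hc', sub_self]
  rw [zTwo, hset, csInf_singleton]

lemma deltaSlope_eq (hv : v ≠ 0) (hα : α ∈ Ioo (0 : ℝ) 1)
    (hb : IsTangency (upperQuantile (logNormal m v)) α b) {c : ℝ}
    (hc : c ∈ Ioo 0 (upperQuantile (logNormal m v) α)) {z : ℝ} (hz : z ∈ Ioo (0 : ℝ) 1) :
    deltaSlope (logNormal m v) α (α * (b c - c)) z
      = envelopeSlope (b c - c) c (upperQuantile (logNormal m v) z) := by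
  have hbc := hb.le c (Ioo_subset_Icc_self hc)
  have hdiv : α * (b c - c) / α = b c - c := mul_div_cancel_left₀ _ hα.1.ne'
  have hcb : c ≤ b c := hc.2.le.trans hbc
  have hqw := upperQuantile_one_sub_cdf (m := m) hv hc.1
  have hb0 : 0 < b c := hc.1.trans_le hcb
  rw [deltaSlope, zOne, sMap, zTwo_eq hv hα hb hc, hdiv]
  change (if z ≤ 1 - cdf _ (upperQuantile _ (1 - cdf _ c) + (b c - c)) then
    upperQuantile _ z - (b c - c) else if z ≤ _ then upperQuantile _ (1 - cdf _ c) else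
    upperQuantile _ z) = _
  rw [hqw, add_sub_cancel]
  simp only [le_one_sub_cdf_iff hv hb0 hz, le_one_sub_cdf_iff hv hc.1 hz]
  split_ifs with h1 h2
  · rw [envelopeSlope_of_ge (by linarith), max_eq_left (by linarith)]
  · rw [envelopeSlope_of_mem h2 (by linarith)]
  · rw [envelopeSlope_of_le (by linarith) (by linarith)]

lemma excessDemand_eq_zero (hU : IsUtility U) (hℓ : 0 < ℓ) {y : ℝ} (h : deriv U ℓ ≤ y) :
    excessDemand U ℓ y = 0 := by
  have h1 := hU.strictAntiOn_invMarginal.antitoneOn (hU.deriv_pos hℓ)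
    (mem_Ioi.2 ((hU.deriv_pos hℓ).trans_le h)) h
  rw [hU.invMarginal_deriv hℓ] at h1
  exact max_eq_right (by linarith)

lemma excessDemand_of_le (hU : IsUtility U) (hℓ : 0 < ℓ) {y : ℝ} (hy : 0 < y)
    (h : y ≤ deriv U ℓ) : excessDemand U ℓ y = invMarginal U y - ℓ := by
  have h1 := hU.strictAntiOn_invMarginal.antitoneOn hy (hU.deriv_pos hℓ) h
  rw [hU.invMarginal_deriv hℓ] at h1
  exact max_eq_left (by linarith)

/-- `G*` is the demand at the price `ν` times the slope of the envelope. -/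
lemma Gstar_eq (hv : v ≠ 0) (hU : IsUtility U) (hα : α ∈ Ioo (0 : ℝ) 1) (hℓ : 0 ≤ ℓ) (hν : 0 < ν)
    (hb : IsTangency (upperQuantile (logNormal m v)) α b) {c : ℝ}
    (hc : c ∈ Ioo 0 (upperQuantile (logNormal m v) α)) :
    EqOn (Gstar (logNormal m v) U α ℓ (α * (b c - c)) ν)
      (fun z => excessDemand U ℓ
        (ν * envelopeSlope (b c - c) c (upperQuantile (logNormal m v) z))) (Ioo 0 1) := by
  intro z hz
  have hq := isKernel_upperQuantile m hv
  have hqz := hq.pos hz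
  have hbc := hb.le c (Ioo_subset_Icc_self hc)
  have ha : 0 ≤ b c - c := by linarith [hc.2]
  have hdiv : α * (b c - c) / α = b c - c := mul_div_cancel_left₀ _ hα.1.ne'
  have hslope := envelopeSlope_pos (a := b c - c) hc.1 hqz
  have hw := one_sub_cdf_mem (m := m) hv hc.1
  simp only [Gstar, zTwo_eq hv hα hb hc, deltaSlope_eq hv hα hb hc hz, hdiv, startPoint, zero_add]
  rcases hℓ.eq_or_lt with rfl | hℓ
  · simp only [if_true, if_pos hw.1.le, if_neg (not_le.2 hz.1)]
    exact (max_eq_left (by linarith [hU.invMarginal_pos (mul_pos hν hslope)])).symm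
  have hx : 0 < deriv U ℓ / ν := div_pos (hU.deriv_pos hℓ) hν
  -- demand vanishes exactly where the price density is at least `U'(ℓ) / ν`
  have hzero : ∀ y, deriv U ℓ / ν ≤ y → excessDemand U ℓ (ν * y) = 0 := fun y hy =>
    excessDemand_eq_zero hU hℓ (by rwa [div_le_iff₀' hν] at hy)
  have hnz : ∀ y, 0 < y → y ≤ deriv U ℓ / ν →
      excessDemand U ℓ (ν * y) = invMarginal U (ν * y) - ℓ := fun y hy0 hy =>
    excessDemand_of_le hU hℓ (mul_pos hν hy0) (by rwa [le_div_iff₀' hν] at hy)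
  simp only [if_neg hℓ.ne', le_one_sub_cdf_iff hv (add_pos_of_nonneg_of_pos ha hx) hz,
    le_one_sub_cdf_iff hv hx hz]
  have hiff : 1 - cdf (logNormal m v) (deriv U ℓ / ν) ≤ 1 - cdf (logNormal m v) c
      ↔ c ≤ deriv U ℓ / ν := by
    rw [le_one_sub_cdf_iff hv hc.1 (one_sub_cdf_mem hv hx), upperQuantile_one_sub_cdf hv hx]
  simp only [hiff]
  split_ifs with h1 h2 h2
  · refine (hzero _ (le_trans ?_ (le_max_left _ _))).symm
    linarith
  · rw [hnz _ hslope]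
    exact max_le (by linarith) ((min_le_left _ _).trans h1)
  · rw [hzero]
    exact (le_min (not_le.1 h1).le h2).trans (min_le_envelopeSlope _ _ _)
  · have h3 : envelopeSlope (b c - c) c (upperQuantile (logNormal m v) z)
        = upperQuantile (logNormal m v) z := envelopeSlope_of_le ha (by linarith)
    rw [h3, hnz _ hqz (not_le.1 h2).le]
    rfl

/-- At the right end of the tangency curve the tail constraint binds in the problem without
tail constraint. -/
lemma lamLow_eq (hv : v ≠ 0) (hU : IsUtility U) (hα : α ∈ Ioo (0 : ℝ) 1) (hℓ : 0 ≤ ℓ)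
    (hb : IsTangency (upperQuantile (logNormal m v)) α b) {zlow : ℝ} (hz : 0 < zlow)
    {r : ℝ → ℝ}
    (hr : IsMultiplier (excessDemand U ℓ) (upperQuantile (logNormal m v)) α b (α * zlow) r) :
    lamLow (logNormal m v) U α ℓ zlow = r (upperQuantile (logNormal m v) α) := by
  have hq := isKernel_upperQuantile m hv
  have hW := hU.isDemand hℓ
  have hα0 := hα.1
  have hpos := hr.pos _ (hq.right_mem hα)
  have heq := hr.eq _ (hq.right_mem hα)
  rw [hb.curveSlope_self hq hα] at heq
  have ht : 0 < α * zlow := mul_pos hα.1 hz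
  have hset : {lam : ℝ | 0 < lam ∧
      1 / α * ∫ z in Ioo (0 : ℝ) α, mertonQuantile (logNormal m v) U ℓ lam z = zlow}
      = {r (upperQuantile (logNormal m v) α)} := by
    ext lam
    have hiff : 1 / α * ∫ z in Ioo (0 : ℝ) α, mertonQuantile (logNormal m v) U ℓ lam z = zlow ↔
        tailDemand (excessDemand U ℓ) α (upperQuantile (logNormal m v)) lam = α * zlow := by
      rw [one_div, inv_mul_eq_iff_eq_mul₀ hα.1.ne']
      rfl
    simp only [mem_ofPred_eq, mem_singleton_iff, hiff]
    constructor
    · rintro ⟨hlam, h⟩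
      rcases lt_trichotomy lam (r (upperQuantile (logNormal m v) α)) with h1 | h1 | h1
      · have := hq.isPrice.tailDemand_lt hW hα hlam h1 (by rw [h]; exact ht)
        linarith
      · exact h1
      · have := hq.isPrice.tailDemand_lt hW hα hpos h1 (by rw [heq]; exact ht)
        linarith
    · rintro rfl
      exact ⟨hpos, heq⟩
  rw [lamLow, hset, csInf_singleton]

end LogNormal

/-! ### Finiteness from the benchmark problem -/

section Benchmark

variable {Ω : Type*} [MeasurableSpace Ω] {P : Measure Ω} {ρ : Ω → ℝ} {q U : ℝ → ℝ}

/-- A function of the pricing kernel whose cost exhausts the budget is a candidate of the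
benchmark problem, so that its expected utility is finite. -/
lemma integrableOn_utility_of_benchmark (hρ : Measurable ρ) (hq : IsKernel q)
    (hmap : P.map ρ = (volume.restrict (Ioo (0 : ℝ) 1)).map q) (hU : IsUtility U) {ℓ z₀ : ℝ}
    (hℓ : 0 ≤ ℓ) (hwell : BenchmarkWellPosed P ρ U ℓ z₀) {D : ℝ → ℝ} (hD : ∀ x, 0 ≤ D x)
    (hDc : ContinuousOn D (Ioi 0)) (hDq : IntegrableOn (fun z => D (q z) * q z) (Ioo 0 1))
    (hbudget : ∫ z in Ioo (0 : ℝ) 1, D (q z) * q z = zBar P ρ ℓ z₀) :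
    IntegrableOn (fun z => U (D (q z) + ℓ)) (Ioo 0 1) := by
  classical
  set E : ℝ → ℝ := (Ioi (0 : ℝ)).piecewise D fun _ => 0 with hE
  have hEm : Measurable E := hDc.measurable_piecewise continuousOn_const measurableSet_Ioi
  have hE0 : ∀ x, 0 ≤ E x := fun x => by
    by_cases h : x ∈ Ioi (0 : ℝ)
    · rw [hE, piecewise_eq_of_mem _ _ _ h]
      exact hD x
    · rw [hE, piecewise_eq_of_notMem _ _ _ h]
  have hEq : ∀ z ∈ Ioo (0 : ℝ) 1, E (q z) = D (q z) := fun z hz =>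
    piecewise_eq_of_mem _ _ _ (hq.pos hz)
  have hqm : AEMeasurable q (volume.restrict (Ioo 0 1)) := hq.integrableOn.aemeasurable
  have htr : ∀ {g : ℝ → ℝ}, Measurable g → (Integrable (fun ω => g (ρ ω)) P ↔
      IntegrableOn (fun z => g (q z)) (Ioo 0 1)) ∧
      ∫ ω, g (ρ ω) ∂P = ∫ z in Ioo (0 : ℝ) 1, g (q z) := fun {g} hg => by
    constructor
    · have h1 := integrable_map_measure (f := ρ) (μ := P) hg.aestronglyMeasurable hρ.aemeasurable
      have h2 := integrable_map_measure (f := q) hg.aestronglyMeasurable hqm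
      rw [hmap] at h1
      exact h1.symm.trans h2
    · rw [← integral_map hρ.aemeasurable hg.aestronglyMeasurable, hmap,
        integral_map hqm hg.aestronglyMeasurable]
  have hg : Measurable fun x => x * (E x + ℓ) := measurable_id.mul (hEm.add_const ℓ)
  have hcongr : EqOn (fun z => D (q z) * q z + ℓ * q z) (fun z => q z * (E (q z) + ℓ))
      (Ioo 0 1) := fun z hz => by
    simp only [hEq z hz]
    ring
  have hint : IntegrableOn (fun z => D (q z) * q z + ℓ * q z) (Ioo 0 1) :=
    hDq.add (hq.integrableOn.const_mul ℓ)
  have hfeas : BenchmarkFeasible P ρ ℓ z₀ fun ω => E (ρ ω) + ℓ := by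
    refine ⟨(hEm.comp hρ).add_const ℓ, Eventually.of_forall fun ω => ?_, ?_, ?_⟩
    · linarith [hE0 (ρ ω)]
    · exact (htr hg).1.2 (hint.congr_fun hcongr measurableSet_Ioo)
    · have h1 : ∫ ω, ρ ω ∂P = ∫ z in Ioo (0 : ℝ) 1, q z := (htr measurable_id).2
      rw [(htr hg).2, ← setIntegral_congr_fun measurableSet_Ioo hcongr,
        integral_add hDq (hq.integrableOn.const_mul ℓ), integral_const_mul, hbudget, zBar, h1]
      linarith
  have hfin : ∫⁻ ω, ENNReal.ofReal (U (E (ρ ω) + ℓ)) ∂P < ⊤ :=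
    (le_iSup₂ (f := fun (Z : Ω → ℝ) (_ : BenchmarkFeasible P ρ ℓ z₀ Z) =>
      ∫⁻ ω, ENNReal.ofReal (U (Z ω)) ∂P) _ hfeas).trans_lt hwell.2
  -- `U` is monotone on `[0, ∞)` only, so it is extended by a constant to get measurability
  have hV : Measurable fun x => U (max x 0) :=
    Monotone.measurable fun x y hxy =>
      hU.strictMonoOn.monotoneOn (mem_Ici.2 (le_max_right _ _)) (mem_Ici.2 (le_max_right _ _))
        (max_le_max_right _ hxy)
  have hVE : Measurable fun x => U (E x + ℓ) := by
    have h : (fun x => U (E x + ℓ)) = (fun x => U (max x 0)) ∘ fun x => E x + ℓ := by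
      ext x
      simp only [Function.comp_apply, max_eq_left (add_nonneg (hE0 x) hℓ)]
    rw [h]
    exact hV.comp (hEm.add_const ℓ)
  have hfin' : ∫⁻ z in Ioo (0 : ℝ) 1, ENNReal.ofReal (U (E (q z) + ℓ)) < ⊤ := by
    have h1 := lintegral_map' (f := fun x => ENNReal.ofReal (U (E x + ℓ))) (μ := P) (g := ρ)
      hVE.ennreal_ofReal.aemeasurable hρ.aemeasurable
    have h2 := lintegral_map' (f := fun x => ENNReal.ofReal (U (E x + ℓ))) (g := q)
      hVE.ennreal_ofReal.aemeasurable hqm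
    rw [← h2, ← hmap, h1]
    exact hfin
  have hmain : IntegrableOn (fun z => U (E (q z) + ℓ)) (Ioo 0 1) :=
    ⟨(hVE.comp_aemeasurable hqm).aestronglyMeasurable,
      (hasFiniteIntegral_iff_ofReal (Eventually.of_forall fun z =>
        hU.nonneg _ (add_nonneg (hE0 _) hℓ))).2 hfin'⟩
  exact hmain.congr_fun (fun z hz => by simp only [hEq z hz]) measurableSet_Ioo

end Benchmark

end TVaRPI

open TVaRPI
theorem theorem4p3
    {Ω : Type*} [MeasurableSpace Ω] (P : Measure Ω) [IsProbabilityMeasure P]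
    -- the pricing kernel is a non-degenerate log-normal random variable with law `μ`
    (ρ : Ω → ℝ) (hρ : Measurable ρ) (m : ℝ) (v : ℝ≥0) (hv : v ≠ 0)
    (μ : Measure ℝ) (hμ : μ = P.map ρ) (hlaw : P.map ρ = logNormal m v)
    (U : ℝ → ℝ) (hU : IsUtility U)
    (α ℓ κ z₀ : ℝ) (hα : α ∈ Ioo (0 : ℝ) 1) (hℓ : 0 ≤ ℓ)
    -- the standing assumption: the benchmark problem is well-posed
    (hwell : 0 < zBar P ρ ℓ z₀ → BenchmarkWellPosed P ρ U ℓ z₀)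
    -- `R(z̲) < z̄ < C(z̲)`, where `C(z̲)` is defined for `z̲ > 0` and finite
    (hzlow : 0 < zLow κ ℓ)
    (hC : IntegrableOn (integrandC μ U α ℓ (zLow κ ℓ)) (Ioo 0 1))
    (hlower : thresholdR μ α (zLow κ ℓ) < zBar P ρ ℓ z₀)
    (hupper : zBar P ρ ℓ z₀ < thresholdC μ U α ℓ (zLow κ ℓ)) :
    ∃ lam ∈ Ioo 0 (lamHat μ α), ∃ ν ∈ Ioi (0 : ℝ),
      -- `G*_{λ,ν}` is the unique optimal solution of the auxiliary problem
      IsUniqueMaximizer IsQuantile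
        (auxObjective μ U α ℓ (zBar P ρ ℓ z₀) (zLow κ ℓ) lam ν) (Gstar μ U α ℓ lam ν) ∧
      -- both constraints hold with equality
      IntegrableOn (fun z => Gstar μ U α ℓ lam ν z * quantile μ (1 - z)) (Ioo 0 1) ∧
      ∫ z in Ioo (0 : ℝ) 1, Gstar μ U α ℓ lam ν z * quantile μ (1 - z) = zBar P ρ ℓ z₀ ∧
      1 / α * ∫ z in Ioo (0 : ℝ) α, Gstar μ U α ℓ lam ν z = zLow κ ℓ ∧
      -- `G*_{λ,ν}` is the optimal solution of the quantile problem
      IsUniqueMaximizer (QuantileFeasible μ α (zBar P ρ ℓ z₀) (zLow κ ℓ))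
        (quantileObjective U ℓ) (Gstar μ U α ℓ lam ν) := by
  obtain rfl : μ = logNormal m v := hμ.trans hlaw
  set q := upperQuantile (logNormal m v) with hqdef
  have hq : IsKernel q := isKernel_upperQuantile m hv
  have hW := hU.isDemand hℓ
  have hα0 := hα.1
  have hqα := hq.pos hα
  have ht : 0 < α * zLow κ ℓ := mul_pos hα0 hzlow
  obtain ⟨b, hb⟩ := hq.exists_isTangency hα
  obtain ⟨r, hr⟩ := hb.exists_isMultiplier hq hW hα ht
  have hlamLow := lamLow_eq hv hU hα hℓ hb hzlow hr
  have hlamHat := lamHat_eq hv hα hb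
  have hC' : IntegrableOn (fun z => excessDemand U ℓ (r (q α) * q z) * q z) (Ioo 0 1) := by
    rw [← hlamLow]
    exact hC
  have hupper' : zBar P ρ ℓ z₀
      < ∫ z in Ioo (0 : ℝ) 1, excessDemand U ℓ (r (q α) * q z) * q z := by
    rw [← hlamLow]
    exact hupper
  have hlower' : b 0 * (α * zLow κ ℓ) < zBar P ρ ℓ z₀ := by
    rw [thresholdR, hlamHat] at hlower
    linarith
  obtain ⟨c, hc, hcz⟩ := hr.exists_curveBudget_eq hb hq hW hα ht hC' hlower' hupper'
  have hc1 : c ∈ Ioc 0 (q α) := Ioo_subset_Ioc_self hc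
  have hc2 : c ∈ Icc 0 (q α) := Ioo_subset_Icc_self hc
  have hbc := hb.le c hc2
  have hb0 := hb.le 0 ⟨le_rfl, hqα.le⟩
  have hν := hr.pos c hc1
  have hdiv : α * (b c - c) / α = b c - c := mul_div_cancel_left₀ _ hα0.ne'
  have hEq := Gstar_eq hv hU hα hℓ hν hb hc
  set G := Gstar (logNormal m v) U α ℓ (α * (b c - c)) (r c) with hG
  have hcostEq : EqOn (fun z => curveDemand (excessDemand U ℓ) q b r c z * q z)
      (fun z => G z * q z) (Ioo 0 1) := fun z hz => by
    simp only [hEq hz, curveDemand, curveSlope, hqdef]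
  have hcost : IntegrableOn (fun z => G z * q z) (Ioo 0 1) :=
    (hr.integrableOn hb hq hW hα ht hC' hc1).congr_fun hcostEq measurableSet_Ioo
  have hbar : ∫ z in Ioo (0 : ℝ) 1, G z * q z = zBar P ρ ℓ z₀ := by
    rw [← setIntegral_congr_fun measurableSet_Ioo hcostEq]
    exact hcz
  have hlow : 1 / α * ∫ z in Ioo 0 α, G z = zLow κ ℓ := by
    rw [setIntegral_congr_fun measurableSet_Ioo (hEq.mono (Ioo_zero_subset hα)), one_div,
      inv_mul_eq_iff_eq_mul₀ hα0.ne']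
    exact hr.eq c hc1
  have hzbar : 0 < zBar P ρ ℓ z₀ := lt_trans (mul_pos (hqα.trans_le hb0) ht) hlower'
  have hutil : IntegrableOn (fun z => U (G z + ℓ)) (Ioo 0 1) := by
    have hDc : ContinuousOn (fun x => excessDemand U ℓ (r c * envelopeSlope (b c - c) c x))
        (Ioi 0) := by
      refine hW.continuousOn.comp (f := fun x => r c * envelopeSlope (b c - c) c x) ?_
        fun x hx => mul_pos hν (envelopeSlope_pos hc.1 hx)
      unfold envelopeSlope
      exact Continuous.continuousOn (by fun_prop)
    refine (integrableOn_utility_of_benchmark hρ hq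
      (hlaw.trans (map_quantile_logNormal hv).symm) hU hℓ (hwell hzbar) (fun _ => hW.nonneg _) hDc
      (hr.integrableOn hb hq hW hα ht hC' hc1) hcz).congr_fun (fun z hz => ?_) measurableSet_Ioo
    simp only [hEq hz, hqdef]
  have henv : IsEnvelopeDemand U q ℓ α (b c) c (r c) G :=
    ⟨hc.1, hc.2.le, hbc, hb.eq c hc2, hν, hEq, hcost, hutil⟩
  refine ⟨α * (b c - c), ⟨mul_pos hα0 (by linarith [hc.2]), ?_⟩, r c, hν, ?_, hcost, hbar, hlow,
    henv.isUniqueMaximizer_quantile hU hℓ hq hα hbar hlow⟩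
  · rw [hlamHat]
    have := hb.antitoneOn hq hα ⟨le_rfl, hqα.le⟩ hc2 hc.1.le
    exact mul_lt_mul_of_pos_left (by linarith [hc.1]) hα0
  · have h := henv.isUniqueMaximizer_aux hU hℓ hq hα
      (r c * zBar P ρ ℓ z₀ - α * (b c - c) * r c * zLow κ ℓ)
    have hobj : auxObjective (logNormal m v) U α ℓ (zBar P ρ ℓ z₀) (zLow κ ℓ) (α * (b c - c)) (r c)
        = fun H => extIntegral (auxIntegrand U q ℓ α (b c - c) (r c) H)
          + ((r c * zBar P ρ ℓ z₀ - α * (b c - c) * r c * zLow κ ℓ : ℝ) : EReal) := by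
      rw [← hdiv]
      simp only [hdiv]
      funext H
      unfold auxObjective phi'
      rw [hdiv]
      rfl
    rw [hobj]
    exact h
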